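/- Let $V$ be a real-valued function of class $C^1$ on $[0,1]$ (one-sided derivatives at the end points). For $u_0\in L^2([0,1])$, a global solution of the forced Burgers problem $$\partial_t u+u\,\partial_x u=\partial_{xx}^2u+2\,\partial_xV,\qquad u(t,0)=u(t,1)=0,\qquad u(0,\cdot)=u_0$$ means a continuous map $u:[0,\infty)\to L^2([0,1])$ with $u(0)=u_0$ which, on $(0,\infty)\times[0,1]$, is given by a function such that it and its derivatives $\partial_tu,\partial_xu,\partial_{xx}^2u$ exist and are continuous up to the boundary points $x=0,1$, satisfying there the equation and the Dirichlet conditions. For every $u_0\in L^2([0,1])$ there is exactly one global solution $t\mapsto\Phi^t_{\mathcal B}(u_0)$, and $(\Phi^t_{\mathcal B})_{t\ge 0}$ is a (semi)flow on $L^2([0,1])$: $\Phi^0_{\mathcal B}=\mathrm{id}$, $\Phi^{t+s}_{\mathcal B}=\Phi^t_{\mathcal B}\circ\Phi^s_{\mathcal B}$, and $(t,u_0)\mapsto\Phi^t_{\mathcal B}(u_0)$ is continuous. The operator $-\partial_{xx}^2+V$ on $[0,1]$ with Neumann conditions $\partial_xe(0)=\partial_xe(1)=0$ has a unique positive ground state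 $e_0$, that is, an eigenfunction for the lowest eigenvalue with $\int_0^1e_0^2=1$ and $e_0>0$ on $[0,1]$. The flow $\Phi^t_{\mathcal B}$ has a unique steady state, i.e. there is exactly one $s\in L^2([0,1])$ such that $\Phi^t_{\mathcal B}(s)=s$ for all $t\ge0$, namely $$s_0=-2\,\frac{\partial_xe_0}{e_0}.$$ This state is a sink attracting all orbits: for every $u_0\in L^2([0,1])$, $\Phi^t_{\mathcal B}(u_0)\to s_0$ in $L^2([0,1])$ as $t\to\infty$. -/

import Mathlib

open Set Filter Topology MeasureTheory
open scoped NNReal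

/-- The Hilbert space `L²([0,1])` of real-valued functions. -/
abbrev L2I : Type := Lp ℝ 2 (volume.restrict (Icc (0 : ℝ) 1))

/-- `w` is a classical solution for positive times, i.e. on `(0,∞) × [0,1]`, of
`∂ₜ w + w ∂ₓ w = ∂ₓₓ w + 2 ∂ₓ V` with `w(t,0) = w(t,1) = 0`: the function `w` and the derivatives
`wt = ∂ₜ w`, `wx = ∂ₓ w`, `wxx = ∂ₓₓ w` exist and are continuous on `(0,∞) × [0,1]`
(`x`-derivatives are one-sided at the end points `0` and `1`). -/
def IsClassicalBurgersSolution (V : ℝ → ℝ) (w : ℝ → ℝ → ℝ) : Prop :=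
  ∃ wt wx wxx : ℝ → ℝ → ℝ,
    ContinuousOn (fun p : ℝ × ℝ => w p.1 p.2) (Ioi 0 ×ˢ Icc 0 1) ∧
    ContinuousOn (fun p : ℝ × ℝ => wt p.1 p.2) (Ioi 0 ×ˢ Icc 0 1) ∧
    ContinuousOn (fun p : ℝ × ℝ => wx p.1 p.2) (Ioi 0 ×ˢ Icc 0 1) ∧
    ContinuousOn (fun p : ℝ × ℝ => wxx p.1 p.2) (Ioi 0 ×ˢ Icc 0 1) ∧
    (∀ t > 0, w t 0 = 0 ∧ w t 1 = 0) ∧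
    ∀ t > 0, ∀ x ∈ Icc (0 : ℝ) 1,
      HasDerivAt (fun τ => w τ x) (wt t x) t ∧
      HasDerivWithinAt (w t) (wx t x) (Icc 0 1) x ∧
      HasDerivWithinAt (wx t) (wxx t x) (Icc 0 1) x ∧
      wt t x + w t x * wx t x = wxx t x + 2 * derivWithin V (Icc 0 1) x

/-- `u : [0,∞) → L²([0,1])` is a global solution of the Cauchy problem for the forced Burgers
equation with datum `u₀ ∈ L²([0,1])`: it is continuous with values in `L²([0,1])`, starts at `u₀`,
and is a classical solution for `t > 0`. -/
def IsGlobalBurgersSolution (V : ℝ → ℝ) (u₀ : L2I) (u : ℝ≥0 → L2I) : Prop :=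
  Continuous u ∧ u 0 = u₀ ∧
    ∃ w : ℝ → ℝ → ℝ, IsClassicalBurgersSolution V w ∧
      ∀ t : ℝ≥0, 0 < t → (u t : ℝ → ℝ) =ᵐ[volume.restrict (Icc (0 : ℝ) 1)] w t

/-- `e` is a (nonzero) eigenfunction on `[0,1]` of `-∂ₓₓ + V` with Neumann boundary conditions,
for the eigenvalue `μ`. -/
structure IsNeumannEigenfunction (V : ℝ → ℝ) (μ : ℝ) (e : ℝ → ℝ) : Prop where
  contDiffOn : ContDiffOn ℝ 2 e (Icc 0 1)
  eigen : ∀ x ∈ Icc (0 : ℝ) 1, -iteratedDerivWithin 2 e (Icc 0 1) x + V x * e x = μ * e x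
  neumann_zero : derivWithin e (Icc 0 1) 0 = 0
  neumann_one : derivWithin e (Icc 0 1) 1 = 0
  ne_zero : ∃ x ∈ Icc (0 : ℝ) 1, e x ≠ 0

/-- `e` is a positive ground state, normalized in `L²([0,1])`, of `-∂ₓₓ + V` with Neumann boundary
conditions: a positive eigenfunction for the lowest eigenvalue. -/
def IsPositiveGroundState (V : ℝ → ℝ) (e : ℝ → ℝ) : Prop :=
  (∃ μ : ℝ, IsNeumannEigenfunction V μ e ∧
    ∀ (ν : ℝ) (f : ℝ → ℝ), IsNeumannEigenfunction V ν f → μ ≤ ν) ∧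
  (∀ x ∈ Icc (0 : ℝ) 1, 0 < e x) ∧
  ∫ x in (0 : ℝ)..1, e x ^ 2 = 1

/-! ### Calculus on the unit interval -/

/-! The Cole–Hopf substitution `u = -2 ∂ₓψ/ψ` linearizes the equation. With `ψ = e φ`, where `e` is
the ground state and `λ` its eigenvalue, the linear equation `∂ₜψ = ∂ₓₓψ - (V - λ)ψ` becomes `e² ∂ₜφ
= ∂ₓ(e² ∂ₓφ)` with Neumann conditions. The function `w = e ∂ₓφ` then solves `∂ₜw = -D D* w` with
Dirichlet conditions, where `D = e ∂ₓ e⁻¹`. The inverse `K` of `D D*` is an explicit positive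
injective bounded operator on `L²`, so functional calculus of `K` gives an orbit that is smooth for
`t > 0` and tends to zero (`exists_heat_orbit`). The potential `φ` is recovered from `w` up to a
constant `c`, its conserved `e²`-mean. Hence `φ → c` and `u → -2 ∂ₓe/e`.

Every `L²` datum is a Cole–Hopf image (`exists_coleHopf_eq`). The minimum principle keeps `φ` above
a positive constant, and there the Cole–Hopf map is locally Lipschitz (`exists_coleHopf_sub_le`);
continuity and convergence in `L²` therefore transfer from `w` to `u` (`exists_solution`).

Uniqueness and continuous dependence come from energy estimates for Burgers itself
(`norm_sub_sq_le`), using only `L²` bounds, which hold down to `t = 0`. The ground state is built by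
shooting in the Riccati equation of its logarithmic derivative (`exists_riccati`); a Wronskian
argument shows that its eigenvalue is lowest and simple. The steady state is fixed because it is the
limit of an orbit of a continuous semiflow, and it is the only one because a constant orbit must
equal its limit. -/

theorem uIcc_zero_subset_Icc {x : ℝ} (hx : x ∈ Icc (0 : ℝ) 1) : uIcc 0 x ⊆ Icc 0 1 := by
  rw [uIcc_of_le hx.1]; exact Icc_subset_Icc_right hx.2

theorem ContinuousOn.intervalIntegrable_zero {E : Type*} [NormedAddCommGroup E] {g : ℝ → E}
    (hg : ContinuousOn g (Icc 0 1)) {x : ℝ} (hx : x ∈ Icc (0 : ℝ) 1) :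
    IntervalIntegrable g volume 0 x :=
  (hg.mono (uIcc_zero_subset_Icc hx)).intervalIntegrable

theorem integral_zero_eq_sub {E : Type*} [NormedAddCommGroup E] [NormedSpace ℝ E]
    [CompleteSpace E] {f f' : ℝ → E}
    (hf : ∀ x ∈ Icc (0 : ℝ) 1, HasDerivWithinAt f (f' x) (Icc 0 1) x)
    (hf' : ContinuousOn f' (Icc 0 1)) {x : ℝ} (hx : x ∈ Icc (0 : ℝ) 1) :
    ∫ y in (0 : ℝ)..x, f' y = f x - f 0 := by
  apply intervalIntegral.integral_eq_sub_of_hasDerivAt_of_le hx.1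
  · exact fun y hy => ((hf y ⟨hy.1, hy.2.trans hx.2⟩).continuousWithinAt).mono
      (Icc_subset_Icc_right hx.2)
  · exact fun y hy => (hf y ⟨hy.1.le, (hy.2.trans_le hx.2).le⟩).hasDerivAt
      (Icc_mem_nhds hy.1 (hy.2.trans_le hx.2))
  · exact hf'.intervalIntegrable_zero hx

theorem hasDerivWithinAt_integral_zero {E : Type*} [NormedAddCommGroup E] [NormedSpace ℝ E]
    [CompleteSpace E] {g : ℝ → E} (hg : ContinuousOn g (Icc 0 1)) {x : ℝ}
    (hx : x ∈ Icc (0 : ℝ) 1) :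
    HasDerivWithinAt (fun x => ∫ y in (0 : ℝ)..x, g y) (g x) (Icc 0 1) x := by
  have h01 : (0 : ℝ) ≤ 1 := zero_le_one
  -- Extending `g` by its end values gives a continuous function on the line, so the two-sided
  -- fundamental theorem applies even at `0` and `1`.
  have hG : Continuous (IccExtend h01 ((Icc 0 1).domRestrict g)) :=
    hg.domRestrict.Icc_extend'
  have h := (hG.integral_hasStrictDerivAt 0 x).hasDerivAt.hasDerivWithinAt (s := Icc 0 1)
  have e : ∀ y ∈ Icc (0 : ℝ) 1, IccExtend h01 ((Icc 0 1).domRestrict g) y = g y := fun y hy => by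
    rw [IccExtend_of_mem _ _ hy]; rfl
  rw [e x hx] at h
  refine h.congr (fun y hy => ?_) ?_
  · exact intervalIntegral.integral_congr fun z hz => (e z (uIcc_zero_subset_Icc hy hz)).symm
  · exact intervalIntegral.integral_congr fun z hz => (e z (uIcc_zero_subset_Icc hx hz)).symm

theorem integral_mul_deriv_add_deriv_mul_zero {f g f' g' : ℝ → ℝ}
    (hf : ∀ x ∈ Icc (0 : ℝ) 1, HasDerivWithinAt f (f' x) (Icc 0 1) x)
    (hg : ∀ x ∈ Icc (0 : ℝ) 1, HasDerivWithinAt g (g' x) (Icc 0 1) x)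
    (hf' : ContinuousOn f' (Icc 0 1)) (hg' : ContinuousOn g' (Icc 0 1)) :
    ∫ x in (0 : ℝ)..1, f x * g' x = f 1 * g 1 - f 0 * g 0 - ∫ x in (0 : ℝ)..1, f' x * g x := by
  have hfc : ContinuousOn f (Icc 0 1) := fun x hx => (hf x hx).continuousWithinAt
  have hgc : ContinuousOn g (Icc 0 1) := fun x hx => (hg x hx).continuousWithinAt
  have h1 : (1 : ℝ) ∈ Icc (0 : ℝ) 1 := ⟨zero_le_one, le_rfl⟩
  have := integral_zero_eq_sub (f := fun x => f x * g x) (f' := fun x => f' x * g x + f x * g' x)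
    (fun x hx => (hf x hx).mul (hg x hx)) ((hf'.mul hgc).add (hfc.mul hg')) h1
  have h2 := intervalIntegral.integral_add ((hf'.mul hgc).intervalIntegrable_zero h1)
    ((hfc.mul hg').intervalIntegrable_zero h1)
  simp only [Pi.mul_apply] at h2
  linarith

theorem ContinuousOn.slice {E : Type*} [TopologicalSpace E] {F : ℝ × ℝ → E} {s : Set ℝ}
    (hF : ContinuousOn F (s ×ˢ Icc (0 : ℝ) 1)) {t : ℝ} (ht : t ∈ s) :
    ContinuousOn (fun x => F (t, x)) (Icc 0 1) :=
  hF.comp (by fun_prop) fun _ hx => ⟨ht, hx⟩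

/-- Differentiation under the integral sign on `(0,∞) × [0,1]`. -/
theorem hasDerivAt_integral_unit {F F' : ℝ → ℝ → ℝ}
    (hF : ContinuousOn (fun p : ℝ × ℝ => F p.1 p.2) (Ioi 0 ×ˢ Icc 0 1))
    (hF' : ContinuousOn (fun p : ℝ × ℝ => F' p.1 p.2) (Ioi 0 ×ˢ Icc 0 1))
    (hd : ∀ t > 0, ∀ x ∈ Icc (0 : ℝ) 1, HasDerivAt (fun τ => F τ x) (F' t x) t)
    {t : ℝ} (ht : 0 < t) :
    HasDerivAt (fun τ => ∫ x in (0 : ℝ)..1, F τ x) (∫ x in (0 : ℝ)..1, F' t x) t := by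
  have h1 : (1 : ℝ) ∈ Icc (0 : ℝ) 1 := ⟨zero_le_one, le_rfl⟩
  -- A compact time window away from `0`, where nothing is bounded a priori, supplies a constant
  -- dominating function.
  have hsub : Icc (t / 2) (t + 1) ×ˢ Icc (0 : ℝ) 1 ⊆ Ioi 0 ×ˢ Icc 0 1 :=
    prod_mono (fun τ hτ => (half_pos ht).trans_le hτ.1) subset_rfl
  obtain ⟨C, hC⟩ := (isCompact_Icc.prod isCompact_Icc).exists_bound_of_continuousOn
    (hF'.mono hsub)
  have hIoc : uIoc (0 : ℝ) 1 ⊆ Icc 0 1 := by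
    rw [uIoc_of_le zero_le_one]; exact Ioc_subset_Icc_self
  refine (intervalIntegral.hasDerivAt_integral_of_dominated_loc_of_deriv_le
    (s := Icc (t / 2) (t + 1)) (bound := fun _ => C)
    (Icc_mem_nhds (by linarith) (by linarith)) ?_ ((hF.slice ht).intervalIntegrable_zero h1)
    ?_ ?_ intervalIntegrable_const ?_).2
  · filter_upwards [Ioi_mem_nhds ht] with τ hτ
    exact ((hF.slice hτ).mono hIoc).aestronglyMeasurable measurableSet_uIoc
  · exact ((hF'.slice ht).mono hIoc).aestronglyMeasurable measurableSet_uIoc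
  · exact Eventually.of_forall fun x hx τ hτ => hC (τ, x) ⟨hτ, hIoc hx⟩
  · exact Eventually.of_forall fun x hx τ hτ => hd τ ((half_pos ht).trans_le hτ.1) x (hIoc hx)

/-- Grönwall: `exp (-a t) y` is nonincreasing. Only interior derivatives are required, since
solutions are merely continuous at time `0`. -/
theorem le_exp_mul_of_deriv_le {y y' : ℝ → ℝ} {a T : ℝ} (hy : ContinuousOn y (Icc 0 T))
    (hd : ∀ t ∈ Ioo 0 T, HasDerivAt y (y' t) t) (hle : ∀ t ∈ Ioo 0 T, y' t ≤ a * y t)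
    {t : ℝ} (ht : t ∈ Icc 0 T) : y t ≤ Real.exp (a * t) * y 0 := by
  have hanti : AntitoneOn (fun s => Real.exp (-(a * s)) * y s) (Icc 0 T) := by
    refine antitoneOn_of_hasDerivWithinAt_nonpos (convex_Icc 0 T)
      (f' := fun s => Real.exp (-(a * s)) * (y' s - a * y s)) (by fun_prop) ?_ ?_
    · intro s hs
      rw [interior_Icc] at hs
      have h1 : HasDerivAt (fun s : ℝ => Real.exp (-(a * s))) (Real.exp (-(a * s)) * -(a * 1)) s :=
        ((hasDerivAt_id s).const_mul a).neg.exp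
      convert! (h1.mul (hd s hs)).hasDerivWithinAt using 1
      ring
    · intro s hs
      rw [interior_Icc] at hs
      exact mul_nonpos_of_nonneg_of_nonpos (Real.exp_pos _).le (by linarith [hle s hs])
  have h := hanti ⟨le_rfl, ht.1.trans ht.2⟩ ht ht.1
  simp only [mul_zero, neg_zero, Real.exp_zero, one_mul] at h
  calc y t = Real.exp (a * t) * (Real.exp (-(a * t)) * y t) := by
        rw [← mul_assoc, ← Real.exp_add]; simp
    _ ≤ _ := by gcongr

theorem norm_sq_eq_integral {f : L2I} {g : ℝ → ℝ}
    (h : (f : ℝ → ℝ) =ᵐ[volume.restrict (Icc (0 : ℝ) 1)] g) :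
    ‖f‖ ^ 2 = ∫ x in (0 : ℝ)..1, g x ^ 2 := by
  rw [intervalIntegral.integral_of_le zero_le_one, ← integral_Icc_eq_integral_Ioc,
    ← real_inner_self_eq_norm_sq, L2.inner_def]
  refine integral_congr_ae ?_
  filter_upwards [h] with x hx
  rw [hx, real_inner_self_eq_norm_sq, Real.norm_eq_abs, sq_abs]

/-! ### Energy estimates for the forced Burgers equation -/

theorem hasDerivAt_norm_sq {u : ℝ≥0 → L2I} {w wt : ℝ → ℝ → ℝ}
    (hu : ∀ t : ℝ≥0, 0 < t → (u t : ℝ → ℝ) =ᵐ[volume.restrict (Icc (0 : ℝ) 1)] w t)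
    (hw : ContinuousOn (fun p : ℝ × ℝ => w p.1 p.2) (Ioi 0 ×ˢ Icc 0 1))
    (hwt : ContinuousOn (fun p : ℝ × ℝ => wt p.1 p.2) (Ioi 0 ×ˢ Icc 0 1))
    (hd : ∀ t > 0, ∀ x ∈ Icc (0 : ℝ) 1, HasDerivAt (fun τ => w τ x) (wt t x) t)
    {t : ℝ} (ht : 0 < t) :
    HasDerivAt (fun τ : ℝ => ‖u τ.toNNReal‖ ^ 2) (∫ x in (0 : ℝ)..1, 2 * (w t x * wt t x)) t := by
  have h := hasDerivAt_integral_unit (F := fun τ x => w τ x ^ 2)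
    (F' := fun τ x => 2 * (w τ x * wt τ x)) (hw.pow 2) ((hw.mul hwt).const_smul (2 : ℝ))
    (fun t ht x hx => by
      convert! (hd t ht x hx).pow 2 using 1
      ring) ht
  refine h.congr_of_eventuallyEq ?_
  filter_upwards [Ioi_mem_nhds ht] with τ hτ
  have h := norm_sq_eq_integral (hu τ.toNNReal (Real.toNNReal_pos.2 hτ))
  rwa [Real.coe_toNNReal _ (le_of_lt hτ)] at h

theorem integral_sq_add_mul_sq {f g : ℝ → ℝ} (hf : ContinuousOn f (Icc 0 1))
    (hg : ContinuousOn g (Icc 0 1)) (c : ℝ) :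
    ∫ x in (0 : ℝ)..1, (f x ^ 2 + c * g x ^ 2) =
      (∫ x in (0 : ℝ)..1, f x ^ 2) + c * ∫ x in (0 : ℝ)..1, g x ^ 2 := by
  have h1 : (1 : ℝ) ∈ Icc (0 : ℝ) 1 := ⟨zero_le_one, le_rfl⟩
  rw [← intervalIntegral.integral_const_mul, intervalIntegral.integral_add]
  all_goals exact ContinuousOn.intervalIntegrable_zero (by fun_prop) h1

/-- The interpolation inequality `2 ∫ a d d' ≤ 2 ∫ d'² + A² ∫ d²` for `∫ a² ≤ A`, `d(0) = 0`. -/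
theorem two_mul_integral_mul_deriv_le {a d dx : ℝ → ℝ} {A : ℝ} (hA : 0 < A)
    (ha : ContinuousOn a (Icc 0 1)) (hdx : ContinuousOn dx (Icc 0 1))
    (hd : ∀ x ∈ Icc (0 : ℝ) 1, HasDerivWithinAt d (dx x) (Icc 0 1) x) (hd0 : d 0 = 0)
    (haA : ∫ x in (0 : ℝ)..1, a x ^ 2 ≤ A) :
    2 * ∫ x in (0 : ℝ)..1, a x * d x * dx x ≤
      2 * (∫ x in (0 : ℝ)..1, dx x ^ 2) + A ^ 2 * ∫ x in (0 : ℝ)..1, d x ^ 2 := by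
  have h1 : (1 : ℝ) ∈ Icc (0 : ℝ) 1 := ⟨zero_le_one, le_rfl⟩
  have hdc : ContinuousOn d (Icc 0 1) := fun x hx => (hd x hx).continuousWithinAt
  set X := ∫ x in (0 : ℝ)..1, dx x ^ 2 with hX
  set D := ∫ x in (0 : ℝ)..1, d x ^ 2 with hD
  have hsum : ContinuousOn (fun x => dx x ^ 2 + A ^ 2 * d x ^ 2) (Icc 0 1) := by fun_prop
  have hXD : ∫ x in (0 : ℝ)..1, (dx x ^ 2 + A ^ 2 * d x ^ 2) = X + A ^ 2 * D :=
    integral_sq_add_mul_sq hdx hdc _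
  -- Since `d 0 = 0`, `A d²` is the primitive of `2 A d d'`, which is at most `d'² + A² d²`.
  have hsup : ∀ x ∈ Icc (0 : ℝ) 1, A * d x ^ 2 ≤ X + A ^ 2 * D := by
    intro x hx
    have e := integral_zero_eq_sub (f := fun x => A * d x ^ 2)
      (f' := fun x => A * (2 * d x * dx x)) (fun y hy => by
        convert! ((hd y hy).pow 2).const_mul A using 1
        ring) (by fun_prop) hx
    simp only [hd0] at e
    have : A * d x ^ 2 = ∫ y in (0 : ℝ)..x, A * (2 * d y * dx y) := by rw [e]; ring
    rw [this, ← hXD]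
    calc ∫ y in (0 : ℝ)..x, A * (2 * d y * dx y)
        ≤ ∫ y in (0 : ℝ)..x, (dx y ^ 2 + A ^ 2 * d y ^ 2) := by
          refine intervalIntegral.integral_mono_on hx.1 ?_ (hsum.intervalIntegrable_zero hx) ?_
          · exact ContinuousOn.intervalIntegrable_zero (by fun_prop) hx
          · intro y _
            nlinarith [sq_nonneg (dx y - A * d y)]
      _ ≤ _ := by
          refine intervalIntegral.integral_mono_interval le_rfl hx.1 hx.2
            (Eventually.of_forall fun y => ?_) (hsum.intervalIntegrable_zero h1)
          simp only [Pi.zero_apply]; positivity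
  have hM : 0 ≤ X + A ^ 2 * D := by
    have := hsup 0 ⟨le_rfl, zero_le_one⟩
    simpa [hd0] using this
  -- Pointwise `2 a d d' ≤ d'² + a² d²`; the sup bound on `d²` then leaves only the integral of
  -- `a²`, known to be at most `A`.
  have h2 : ∫ x in (0 : ℝ)..1, 2 * (a x * d x * dx x) ≤
      ∫ x in (0 : ℝ)..1, (dx x ^ 2 + (X + A ^ 2 * D) / A * a x ^ 2) := by
    refine intervalIntegral.integral_mono_on zero_le_one
      (ContinuousOn.intervalIntegrable_zero (by fun_prop) h1)
      (ContinuousOn.intervalIntegrable_zero (by fun_prop) h1) fun x hx => ?_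
    have h3 : d x ^ 2 ≤ (X + A ^ 2 * D) / A := by
      rw [le_div_iff₀ hA]; linarith [hsup x hx]
    nlinarith [sq_nonneg (dx x - a x * d x), mul_le_mul_of_nonneg_right h3 (sq_nonneg (a x))]
  rw [intervalIntegral.integral_const_mul, integral_sq_add_mul_sq hdx ha, ← hX] at h2
  have h4 : (X + A ^ 2 * D) / A * ∫ x in (0 : ℝ)..1, a x ^ 2 ≤ X + A ^ 2 * D := by
    calc _ ≤ (X + A ^ 2 * D) / A * A := by gcongr
      _ = _ := by field_simp
  linarith

/-- Test the equation with `2 w`. Convection integrates to a boundary term in `w³`, which vanishes;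
diffusion contributes `-2 ∫ wx²`; and `4 w Vx ≤ w² + 4 Vx²`. -/
theorem burgers_energy_le {w wt wx wxx Vx : ℝ → ℝ} (cwxx : ContinuousOn wxx (Icc 0 1))
    (hVx : ContinuousOn Vx (Icc 0 1)) (hb : w 0 = 0 ∧ w 1 = 0)
    (hd : ∀ x ∈ Icc (0 : ℝ) 1, HasDerivWithinAt w (wx x) (Icc 0 1) x ∧
      HasDerivWithinAt wx (wxx x) (Icc 0 1) x ∧ wt x + w x * wx x = wxx x + 2 * Vx x) :
    ∫ x in (0 : ℝ)..1, 2 * (w x * wt x) ≤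
      (∫ x in (0 : ℝ)..1, w x ^ 2) + 4 * ∫ x in (0 : ℝ)..1, Vx x ^ 2 := by
  have h1 : (1 : ℝ) ∈ Icc (0 : ℝ) 1 := ⟨zero_le_one, le_rfl⟩
  have cw : ContinuousOn w (Icc 0 1) := fun x hx => (hd x hx).1.continuousWithinAt
  have cwx : ContinuousOn wx (Icc 0 1) := fun x hx => (hd x hx).2.1.continuousWithinAt
  have i1 := integral_mul_deriv_add_deriv_mul_zero (fun x hx => (hd x hx).1)
    (fun x hx => (hd x hx).2.1) cwx cwxx
  have i2 := integral_zero_eq_sub (f := fun x => w x ^ 3) (f' := fun x => 3 * w x ^ 2 * wx x)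
    (fun x hx => by convert! (hd x hx).1.pow 3 using 1) (by fun_prop) h1
  rw [hb.1, hb.2] at i1 i2
  have i3 : 0 ≤ ∫ x in (0 : ℝ)..1, wx x * wx x :=
    intervalIntegral.integral_nonneg zero_le_one fun x _ => mul_self_nonneg _
  have i4 : ∫ x in (0 : ℝ)..1, 2 * (w x * wt x) =
      2 * (∫ x in (0 : ℝ)..1, w x * wxx x)
        - 2 / 3 * (∫ x in (0 : ℝ)..1, 3 * w x ^ 2 * wx x)
        + ∫ x in (0 : ℝ)..1, 4 * (w x * Vx x) := by
    rw [← intervalIntegral.integral_const_mul, ← intervalIntegral.integral_const_mul,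
      ← intervalIntegral.integral_sub, ← intervalIntegral.integral_add]
    · refine intervalIntegral.integral_congr fun x hx => ?_
      rw [uIcc_of_le zero_le_one] at hx
      have e : wt x = wxx x + 2 * Vx x - w x * wx x := by linarith [(hd x hx).2.2]
      simp only [e]; ring
    all_goals exact ContinuousOn.intervalIntegrable_zero (by fun_prop) h1
  have i5 : ∫ x in (0 : ℝ)..1, 4 * (w x * Vx x) ≤
      ∫ x in (0 : ℝ)..1, (w x ^ 2 + 4 * Vx x ^ 2) := by
    refine intervalIntegral.integral_mono_on zero_le_one
      (ContinuousOn.intervalIntegrable_zero (by fun_prop) h1)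
      (ContinuousOn.intervalIntegrable_zero (by fun_prop) h1) fun x _ => ?_
    nlinarith [sq_nonneg (w x - 2 * Vx x)]
  rw [integral_sq_add_mul_sq cw hVx] at i5
  linarith

/-- With `d = w - w'` and `a = (w + w')/2`, the forcing cancels and the nonlinearity is `∂ₓ(a d)`.
After integration by parts it becomes `2 ∫ a d ∂ₓd`, whose gradient part the diffusion absorbs by
`two_mul_integral_mul_deriv_le`. -/
theorem burgers_energy_sub_le {A : ℝ} (hA : 0 < A) {w wt wx wxx w' wt' wx' wxx' Vx : ℝ → ℝ}
    (cwxx : ContinuousOn wxx (Icc 0 1)) (cwxx' : ContinuousOn wxx' (Icc 0 1))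
    (hb : w 0 = 0 ∧ w 1 = 0) (hb' : w' 0 = 0 ∧ w' 1 = 0)
    (hd : ∀ x ∈ Icc (0 : ℝ) 1, HasDerivWithinAt w (wx x) (Icc 0 1) x ∧
      HasDerivWithinAt wx (wxx x) (Icc 0 1) x ∧ wt x + w x * wx x = wxx x + 2 * Vx x)
    (hd' : ∀ x ∈ Icc (0 : ℝ) 1, HasDerivWithinAt w' (wx' x) (Icc 0 1) x ∧
      HasDerivWithinAt wx' (wxx' x) (Icc 0 1) x ∧ wt' x + w' x * wx' x = wxx' x + 2 * Vx x)
    (ha : ∫ x in (0 : ℝ)..1, (2⁻¹ * (w x + w' x)) ^ 2 ≤ A) :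
    ∫ x in (0 : ℝ)..1, 2 * ((w x - w' x) * (wt x - wt' x)) ≤
      A ^ 2 * ∫ x in (0 : ℝ)..1, (w x - w' x) ^ 2 := by
  have h1 : (1 : ℝ) ∈ Icc (0 : ℝ) 1 := ⟨zero_le_one, le_rfl⟩
  have cw : ContinuousOn w (Icc 0 1) := fun x hx => (hd x hx).1.continuousWithinAt
  have cwx : ContinuousOn wx (Icc 0 1) := fun x hx => (hd x hx).2.1.continuousWithinAt
  have cw' : ContinuousOn w' (Icc 0 1) := fun x hx => (hd' x hx).1.continuousWithinAt
  have cwx' : ContinuousOn wx' (Icc 0 1) := fun x hx => (hd' x hx).2.1.continuousWithinAt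
  have i0 := two_mul_integral_mul_deriv_le (a := fun x => 2⁻¹ * (w x + w' x))
    (d := fun x => w x - w' x) (dx := fun x => wx x - wx' x) hA (by fun_prop) (by fun_prop)
    (fun x hx => (hd x hx).1.sub (hd' x hx).1) (by simp [hb.1, hb'.1]) ha
  have i1 := integral_mul_deriv_add_deriv_mul_zero (f := fun x => w x - w' x)
    (g := fun x => wx x - wx' x) (f' := fun x => wx x - wx' x)
    (g' := fun x => wxx x - wxx' x) (fun x hx => (hd x hx).1.sub (hd' x hx).1)
    (fun x hx => (hd x hx).2.1.sub (hd' x hx).2.1) (by fun_prop) (by fun_prop)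
  have i2 := integral_mul_deriv_add_deriv_mul_zero (f := fun x => w x - w' x)
    (g := fun x => 2⁻¹ * (w x + w' x) * (w x - w' x)) (f' := fun x => wx x - wx' x)
    (g' := fun x => 2⁻¹ * (wx x + wx' x) * (w x - w' x)
      + 2⁻¹ * (w x + w' x) * (wx x - wx' x))
    (fun x hx => (hd x hx).1.sub (hd' x hx).1)
    (fun x hx => (((hd x hx).1.add (hd' x hx).1).const_mul 2⁻¹).mul
      ((hd x hx).1.sub (hd' x hx).1)) (by fun_prop) (by fun_prop)
  simp only [hb.1, hb.2, hb'.1, hb'.2, sub_self, zero_mul, zero_sub] at i1 i2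
  have i4 : ∫ x in (0 : ℝ)..1, 2 * ((w x - w' x) * (wt x - wt' x)) =
      2 * (∫ x in (0 : ℝ)..1, (w x - w' x) * (wxx x - wxx' x))
        - 2 * (∫ x in (0 : ℝ)..1, (w x - w' x) *
          (2⁻¹ * (wx x + wx' x) * (w x - w' x)
            + 2⁻¹ * (w x + w' x) * (wx x - wx' x))) := by
    rw [← intervalIntegral.integral_const_mul, ← intervalIntegral.integral_const_mul,
      ← intervalIntegral.integral_sub]
    · refine intervalIntegral.integral_congr fun x hx => ?_
      rw [uIcc_of_le zero_le_one] at hx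
      have e : wt x = wxx x + 2 * Vx x - w x * wx x := by linarith [(hd x hx).2.2]
      have e' : wt' x = wxx' x + 2 * Vx x - w' x * wx' x := by linarith [(hd' x hx).2.2]
      simp only [e, e']; ring
    all_goals exact ContinuousOn.intervalIntegrable_zero (by fun_prop) h1
  have i5 : ∫ x in (0 : ℝ)..1, (wx x - wx' x) * (wx x - wx' x) =
      ∫ x in (0 : ℝ)..1, (wx x - wx' x) ^ 2 :=
    intervalIntegral.integral_congr fun x _ => by ring
  have i6 : ∫ x in (0 : ℝ)..1, (wx x - wx' x) * (2⁻¹ * (w x + w' x) * (w x - w' x)) =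
      ∫ x in (0 : ℝ)..1, 2⁻¹ * (w x + w' x) * (w x - w' x) * (wx x - wx' x) :=
    intervalIntegral.integral_congr fun x _ => by ring
  linarith

/-! ### A priori bounds, uniqueness and continuous dependence -/

section

variable {V : ℝ → ℝ}

theorem continuousOn_derivWithin_unit (hV : ContDiffOn ℝ 1 V (Icc 0 1)) :
    ContinuousOn (derivWithin V (Icc 0 1)) (Icc 0 1) :=
  hV.continuousOn_derivWithin (uniqueDiffOn_Icc zero_lt_one) le_rfl

theorem IsGlobalBurgersSolution.norm_sq_le (hV : ContDiffOn ℝ 1 V (Icc 0 1)) {u₀ : L2I}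
    {u : ℝ≥0 → L2I} (h : IsGlobalBurgersSolution V u₀ u) (t : ℝ≥0) :
    ‖u t‖ ^ 2 ≤ Real.exp t *
      (‖u₀‖ ^ 2 + 4 * ∫ x in (0 : ℝ)..1, derivWithin V (Icc 0 1) x ^ 2) := by
  obtain ⟨hc, h0, w, ⟨wt, wx, wxx, hw, hwt, hwx, hwxx, hb, hd⟩, hu⟩ := h
  have hVx := continuousOn_derivWithin_unit hV
  set Vx := derivWithin V (Icc 0 1)
  set C := 4 * ∫ x in (0 : ℝ)..1, Vx x ^ 2 with hC
  have hC0 : 0 ≤ C := mul_nonneg (by norm_num)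
    (intervalIntegral.integral_nonneg zero_le_one fun x _ => sq_nonneg _)
  -- Adding `C` to the squared norm turns `N' ≤ N + C` into the homogeneous inequality `y' ≤ y`.
  have key := le_exp_mul_of_deriv_le (y := fun τ : ℝ => ‖u τ.toNNReal‖ ^ 2 + C) (a := 1) (T := t)
    (y' := fun t => ∫ x in (0 : ℝ)..1, 2 * (w t x * wt t x))
    (by fun_prop)
    (fun s hs => (hasDerivAt_norm_sq hu hw hwt (fun t ht x hx => (hd t ht x hx).1) hs.1).add_const C)
    (fun s hs => ?_) (t := t) ⟨t.2, le_rfl⟩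
  · simp only [Real.toNNReal_coe, one_mul, Real.toNNReal_zero, h0] at key
    linarith
  have hs : 0 < s := hs.1
  have hN : ‖u s.toNNReal‖ ^ 2 = ∫ x in (0 : ℝ)..1, w s x ^ 2 := by
    have h := norm_sq_eq_integral (hu s.toNNReal (Real.toNNReal_pos.2 hs))
    rwa [Real.coe_toNNReal _ hs.le] at h
  rw [hN, one_mul]
  exact burgers_energy_le (hwxx.slice (s := Ioi 0) hs) hVx (hb s hs)
    fun x hx => (hd s hs x hx).2

theorem IsGlobalBurgersSolution.norm_sub_sq_le {u₀ v₀ : L2I}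
    {u v : ℝ≥0 → L2I} (hu : IsGlobalBurgersSolution V u₀ u) (hv : IsGlobalBurgersSolution V v₀ v)
    {A : ℝ} (hA : 0 < A) {T : ℝ≥0} (huv : ∀ t ≤ T, ‖(2 : ℝ)⁻¹ • (u t + v t)‖ ^ 2 ≤ A) :
    ‖u T - v T‖ ^ 2 ≤ Real.exp (A ^ 2 * T) * ‖u₀ - v₀‖ ^ 2 := by
  obtain ⟨hc, h0, w, ⟨wt, wx, wxx, hw, hwt, hwx, hwxx, hb, hd⟩, hu⟩ := hu
  obtain ⟨hc', h0', w', ⟨wt', wx', wxx', hw', hwt', hwx', hwxx', hb', hd'⟩, hu'⟩ := hv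
  have hsub : ∀ t : ℝ≥0, 0 < t → ((u - v) t : ℝ → ℝ) =ᵐ[volume.restrict (Icc (0 : ℝ) 1)]
      fun x => w t x - w' t x := fun t ht => by
    filter_upwards [hu t ht, hu' t ht, Lp.coeFn_sub (u t) (v t)] with x h1 h2 h3
    simp only [Pi.sub_apply] at h3 ⊢
    rw [h3, h1, h2]
  have key := le_exp_mul_of_deriv_le (y := fun τ : ℝ => ‖(u - v) τ.toNNReal‖ ^ 2) (a := A ^ 2)
    (T := T) (y' := fun t => ∫ x in (0 : ℝ)..1, 2 * ((w t x - w' t x) * (wt t x - wt' t x)))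
    (by simp only [Pi.sub_apply]; fun_prop)
    (fun s hs => hasDerivAt_norm_sq hsub (hw.sub hw') (hwt.sub hwt')
      (fun t ht x hx => (hd t ht x hx).1.sub (hd' t ht x hx).1) hs.1)
    (fun s hs => ?_) (t := T) ⟨T.2, le_rfl⟩
  · simpa only [Real.toNNReal_coe, Real.toNNReal_zero, Pi.sub_apply, h0, h0'] using key
  obtain ⟨hs, hsT⟩ := hs
  have hs' : 0 < s.toNNReal := Real.toNNReal_pos.2 hs
  have hN : ‖(u - v) s.toNNReal‖ ^ 2 = ∫ x in (0 : ℝ)..1, (w s x - w' s x) ^ 2 := by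
    have h := norm_sq_eq_integral (hsub s.toNNReal hs')
    rwa [Real.coe_toNNReal _ hs.le] at h
  have ha : ∫ x in (0 : ℝ)..1, (2⁻¹ * (w s x + w' s x)) ^ 2 ≤ A := by
    have h : ((2 : ℝ)⁻¹ • (u s.toNNReal + v s.toNNReal) : L2I) =ᵐ[volume.restrict (Icc (0 : ℝ) 1)]
        fun x => 2⁻¹ * (w s x + w' s x) := by
      filter_upwards [hu _ hs', hu' _ hs', Lp.coeFn_add (u s.toNNReal) (v s.toNNReal),
        Lp.coeFn_smul (2 : ℝ)⁻¹ (u s.toNNReal + v s.toNNReal)] with x h1 h2 h3 h4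
      rw [h4, Pi.smul_apply, h3, Pi.add_apply, h1, h2, Real.coe_toNNReal _ hs.le, smul_eq_mul]
    rw [← norm_sq_eq_integral h]
    exact huv _ (Real.toNNReal_le_iff_le_coe.2 hsT.le)
  rw [hN]
  exact burgers_energy_sub_le hA (hwxx.slice (s := Ioi 0) hs) (hwxx'.slice (s := Ioi 0) hs)
    (hb s hs) (hb' s hs) (fun x hx => (hd s hs x hx).2) (fun x hx => (hd' s hs x hx).2) ha

theorem IsGlobalBurgersSolution.unique {u₀ : L2I}
    {u v : ℝ≥0 → L2I} (hu : IsGlobalBurgersSolution V u₀ u) (hv : IsGlobalBurgersSolution V u₀ v) :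
    u = v := by
  funext T
  have hc : Continuous fun t : ℝ≥0 => ‖(2 : ℝ)⁻¹ • (u t + v t)‖ ^ 2 := by
    have := hu.1; have := hv.1; fun_prop
  obtain ⟨A, hA⟩ := (isCompact_Icc (a := (0 : ℝ≥0)) (b := T)).bddAbove_image hc.continuousOn
  -- The bound comes from compactness of `[0,T]`; the maximum with `1` only ensures positivity.
  have := hu.norm_sub_sq_le hv (A := max A 1) (lt_max_of_lt_right one_pos) (T := T)
    fun t ht => le_max_of_le_left (hA ⟨t, ⟨zero_le, ht⟩, rfl⟩)
  rw [sub_self, norm_zero, zero_pow two_ne_zero, mul_zero] at this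
  exact sub_eq_zero.1 (norm_eq_zero.1 (pow_eq_zero_iff two_ne_zero |>.1
    (le_antisymm this (sq_nonneg _))))

/-- Solutions depend continuously on time and datum, jointly. -/
theorem continuous_of_isGlobalBurgersSolution (hV : ContDiffOn ℝ 1 V (Icc 0 1))
    {Φ : ℝ≥0 → L2I → L2I} (hΦ : ∀ u₀, IsGlobalBurgersSolution V u₀ fun t => Φ t u₀) :
    Continuous (Function.uncurry Φ) := by
  rw [continuous_iff_continuousAt]
  rintro ⟨t₀, u₀⟩
  set C := 4 * ∫ x in (0 : ℝ)..1, derivWithin V (Icc 0 1) x ^ 2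
  have hC0 : 0 ≤ C := mul_nonneg (by norm_num)
    (intervalIntegral.integral_nonneg zero_le_one fun x _ => sq_nonneg _)
  -- By `norm_sq_le`, this bounds the squared norm of every solution starting within distance `1` of
  -- the origin-centred ball of radius `‖u₀‖`, up to time `t₀ + 1`.
  set A := Real.exp (t₀ + 1 : ℝ) * ((‖u₀‖ + 1) ^ 2 + C) with hA
  have hA0 : 0 < A := by positivity
  have hb : ∀ v₀ : L2I, ‖v₀‖ ≤ ‖u₀‖ + 1 → ∀ t : ℝ≥0, t ≤ t₀ + 1 → ‖Φ t v₀‖ ^ 2 ≤ A := by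
    intro v₀ hv t ht
    refine ((hΦ v₀).norm_sq_le hV t).trans ?_
    have : (t : ℝ) ≤ t₀ + 1 := by exact_mod_cast ht
    rw [hA]
    gcongr
  clear_value A
  have hlip : ∀ v₀ : L2I, ‖v₀‖ ≤ ‖u₀‖ + 1 → ∀ t : ℝ≥0, t ≤ t₀ + 1 →
      ‖Φ t v₀ - Φ t u₀‖ ≤ Real.exp (A ^ 2 * (t₀ + 1)) * ‖v₀ - u₀‖ := by
    intro v₀ hv t ht
    have h := (hΦ v₀).norm_sub_sq_le (hΦ u₀) hA0 (T := t) fun s hs => by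
      have h1 := hb v₀ hv s (hs.trans ht)
      have h2 := hb u₀ (by linarith) s (hs.trans ht)
      rw [norm_smul, Real.norm_of_nonneg (by norm_num)]
      have h3 := norm_add_le (Φ s v₀) (Φ s u₀)
      have h4 : ‖Φ s v₀ + Φ s u₀‖ ^ 2 ≤ (‖Φ s v₀‖ + ‖Φ s u₀‖) ^ 2 := by gcongr
      nlinarith [sq_nonneg (‖Φ s v₀‖ - ‖Φ s u₀‖)]
    have ht' : (t : ℝ) ≤ t₀ + 1 := by exact_mod_cast ht
    refine le_of_sq_le_sq ?_ (by positivity)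
    refine h.trans ?_
    -- Squaring doubles the exponent, so the chosen Lipschitz constant is larger than necessary and
    -- no square root appears.
    rw [mul_pow, ← Real.exp_nat_mul]
    refine mul_le_mul_of_nonneg_right (Real.exp_le_exp.2 ?_) (sq_nonneg _)
    have : 0 ≤ A ^ 2 * (t₀ + 1 : ℝ) := by positivity
    push_cast
    nlinarith [mul_le_mul_of_nonneg_left ht' (sq_nonneg A)]
  rw [ContinuousAt, tendsto_iff_norm_sub_tendsto_zero]
  have hcont : Tendsto (fun p : ℝ≥0 × L2I => Real.exp (A ^ 2 * (t₀ + 1)) * ‖p.2 - u₀‖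
      + ‖Φ p.1 u₀ - Φ t₀ u₀‖) (𝓝 (t₀, u₀)) (𝓝 0) := by
    have hc := (hΦ u₀).1
    have : Continuous (fun p : ℝ≥0 × L2I => Real.exp (A ^ 2 * (t₀ + 1)) * ‖p.2 - u₀‖
      + ‖Φ p.1 u₀ - Φ t₀ u₀‖) := by fun_prop
    simpa using this.tendsto (t₀, u₀)
  refine squeeze_zero' (Eventually.of_forall fun p => norm_nonneg _) ?_ hcont
  have e1 : ∀ᶠ p : ℝ≥0 × L2I in 𝓝 (t₀, u₀), p.1 < t₀ + 1 :=
    continuous_fst.continuousAt.eventually_lt continuousAt_const (by simp)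
  have e2 : ∀ᶠ p : ℝ≥0 × L2I in 𝓝 (t₀, u₀), ‖p.2‖ < ‖u₀‖ + 1 :=
    continuous_snd.norm.continuousAt.eventually_lt continuousAt_const (by simp)
  filter_upwards [e1, e2] with p h1 h2
  calc ‖Function.uncurry Φ p - Function.uncurry Φ (t₀, u₀)‖
      = ‖(Φ p.1 p.2 - Φ p.1 u₀) + (Φ p.1 u₀ - Φ t₀ u₀)‖ := by
        simp only [Function.uncurry]; congr 1; abel
    _ ≤ _ := (norm_add_le _ _).trans (by gcongr; exact hlip _ h2.le _ h1.le)

end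

/-! ### The ground state -/

/-- The truncation `min(|x|, K)²` of `x²`. -/
noncomputable def truncSq (K x : ℝ) : ℝ := min |x| K ^ 2

theorem truncSq_nonneg (K x : ℝ) : 0 ≤ truncSq K x := sq_nonneg _

theorem truncSq_le {K : ℝ} (hK : 0 ≤ K) (x : ℝ) : truncSq K x ≤ K ^ 2 := by
  unfold truncSq
  have : 0 ≤ min |x| K := le_min (abs_nonneg x) hK
  gcongr
  exact min_le_right _ _

theorem truncSq_eq {K x : ℝ} (hx : |x| ≤ K) : truncSq K x = x ^ 2 := by
  rw [truncSq, min_eq_left hx, sq_abs]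

theorem lipschitzWith_truncSq (K : ℝ≥0) : LipschitzWith (2 * K) (truncSq K) := by
  refine LipschitzWith.of_dist_le_mul fun x y => ?_
  simp only [Real.dist_eq, truncSq]
  have hx : 0 ≤ min |x| (K : ℝ) := le_min (abs_nonneg x) K.2
  have hy : 0 ≤ min |y| (K : ℝ) := le_min (abs_nonneg y) K.2
  have hx' : min |x| (K : ℝ) ≤ K := min_le_right _ _
  have hy' : min |y| (K : ℝ) ≤ K := min_le_right _ _
  have h1 : |min |x| (K : ℝ) - min |y| (K : ℝ)| ≤ |x - y| := by
    have := abs_min_sub_min_le_max |x| (K : ℝ) |y| K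
    rw [sub_self, abs_zero, max_eq_left (abs_nonneg _)] at this
    exact this.trans (abs_abs_sub_abs_le _ _)
  rw [sq_sub_sq, abs_mul, abs_of_nonneg (add_nonneg hx hy), NNReal.coe_mul, NNReal.coe_ofNat]
  exact mul_le_mul (by linarith) h1 (abs_nonneg _) (by positivity)

/-- Solutions of the truncated Riccati equation. -/
theorem exists_truncated_riccati {V : ℝ → ℝ} (hV : ContinuousOn V (Icc 0 1)) (K : ℝ≥0) (μ : ℝ) :
    ∃ r : ℝ → ℝ, r 0 = 0 ∧ ∀ x ∈ Icc (0 : ℝ) 1,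
      HasDerivWithinAt r (V x - μ - truncSq K (r x)) (Icc 0 1) x := by
  obtain ⟨B, hB⟩ := isCompact_Icc.exists_bound_of_continuousOn hV
  have hB0 : 0 ≤ B := (norm_nonneg _).trans (hB 0 ⟨le_rfl, zero_le_one⟩)
  -- Truncation makes the field bounded and globally Lipschitz. On an interval of length one the
  -- solution moves at most by the bound, so taking it as radius of the ball excludes blow-up.
  have h : IsPicardLindelof (fun t x => V t - μ - truncSq K x)
      (⟨0, le_rfl, zero_le_one⟩ : Icc (0 : ℝ) 1) 0 (B.toNNReal + ‖μ‖₊ + K ^ 2) 0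
      (B.toNNReal + ‖μ‖₊ + K ^ 2) (2 * K) := by
    refine ⟨fun t _ => ?_, fun x _ => by fun_prop, fun t ht x _ => ?_, by simp⟩
    · refine LipschitzWith.lipschitzOnWith (LipschitzWith.of_dist_le_mul fun x y => ?_)
      rw [dist_sub_left]
      exact (lipschitzWith_truncSq K).dist_le_mul x y
    · simp only [NNReal.coe_add, Real.coe_toNNReal _ hB0, coe_nnnorm, NNReal.coe_pow]
      refine (norm_sub_le _ _).trans (add_le_add ((norm_sub_le _ _).trans ?_) ?_)
      · gcongr; exact hB t ht
      · rw [Real.norm_of_nonneg (truncSq_nonneg _ _)]; exact truncSq_le K.2 x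
  exact h.exists_eq_forall_mem_Icc_hasDerivWithinAt₀

theorem HasDerivWithinAt.Ici_of_unit {E : Type*} [NormedAddCommGroup E] [NormedSpace ℝ E]
    {f : ℝ → E} {f' : E} {x : ℝ} (h : HasDerivWithinAt f f' (Icc 0 1) x)
    (hx : x ∈ Ico (0 : ℝ) 1) : HasDerivWithinAt f f' (Ici x) x :=
  h.mono_of_mem_nhdsWithin (mem_of_superset (Icc_mem_nhdsGE hx.2) (Icc_subset_Icc_left hx.1))

/-- The second solution is an approximate trajectory of the first equation with defect `|μ - ν|`.
Grönwall then yields continuity of the shooting value at `1` in the spectral parameter. -/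
theorem truncated_riccati_dist_le {V : ℝ → ℝ} {K : ℝ≥0} {μ ν : ℝ} {r s : ℝ → ℝ}
    (hr0 : r 0 = 0) (hs0 : s 0 = 0)
    (hr : ∀ x ∈ Icc (0 : ℝ) 1, HasDerivWithinAt r (V x - μ - truncSq K (r x)) (Icc 0 1) x)
    (hs : ∀ x ∈ Icc (0 : ℝ) 1, HasDerivWithinAt s (V x - ν - truncSq K (s x)) (Icc 0 1) x) :
    dist (r 1) (s 1) ≤ gronwallBound 0 (2 * K) |μ - ν| 1 := by
  have h := dist_le_of_approx_trajectories_ODE (v := fun t x => V t - μ - truncSq K x)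
    (K := 2 * K) (f := r) (g := s) (a := 0) (b := 1) (δ := 0) (εf := 0) (εg := |μ - ν|)
    (f' := fun x => V x - μ - truncSq K (r x)) (g' := fun x => V x - ν - truncSq K (s x))
    (fun t => LipschitzWith.of_dist_le_mul fun x y => by
      rw [dist_sub_left]
      exact (lipschitzWith_truncSq K).dist_le_mul x y)
    (fun x hx => (hr x hx).continuousWithinAt)
    (fun x hx => (hr x ⟨hx.1, hx.2.le⟩).Ici_of_unit hx)
    (fun x _ => by simp)
    (fun x hx => (hs x hx).continuousWithinAt)
    (fun x hx => (hs x ⟨hx.1, hx.2.le⟩).Ici_of_unit hx)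
    (fun x _ => by rw [Real.dist_eq]; apply le_of_eq; congr 1; ring)
    (by simp [hr0, hs0]) 1 ⟨zero_le_one, le_rfl⟩
  simpa using h

/-- The logarithmic derivative of the ground state: a solution of the Riccati equation
vanishing at both end points, for a suitable value of the spectral parameter. -/
theorem exists_riccati {V : ℝ → ℝ} (hV : ContinuousOn V (Icc 0 1)) :
    ∃ (μ : ℝ) (r : ℝ → ℝ), r 0 = 0 ∧ r 1 = 0 ∧ ∀ x ∈ Icc (0 : ℝ) 1,
      HasDerivWithinAt r (V x - μ - r x ^ 2) (Icc 0 1) x := by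
  obtain ⟨B, hB⟩ := isCompact_Icc.exists_bound_of_continuousOn hV
  have hB0 : 0 ≤ B := (norm_nonneg _).trans (hB 0 ⟨le_rfl, zero_le_one⟩)
  have hB' : ∀ x ∈ Icc (0 : ℝ) 1, -B ≤ V x ∧ V x ≤ B := fun x hx => abs_le.1 (hB x hx)
  lift B to ℝ≥0 using hB0
  -- The least level that dominates `V - μ` for all `μ` in `[-B - 1, B]` using only `|V| ≤ B`.
  set K : ℝ≥0 := 2 * B + 1 with hK
  have hKc : (K : ℝ) = 2 * B + 1 := by rw [hK]; push_cast; rfl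
  choose r hr0 hr using exists_truncated_riccati hV K
  have hcont : Continuous fun μ => r μ 1 := by
    rw [continuous_iff_continuousAt]
    intro μ
    rw [ContinuousAt, tendsto_iff_dist_tendsto_zero]
    have hK0 : (2 * K : ℝ) ≠ 0 := by rw [hKc]; positivity
    have hlim : Tendsto (fun ν => gronwallBound 0 (2 * K) |ν - μ| 1) (𝓝 μ) (𝓝 0) := by
      simp only [gronwallBound_of_K_ne_0 hK0]
      have hc : Continuous fun ν : ℝ => 0 * Real.exp (2 * K * 1) +
          |ν - μ| / (2 * K) * (Real.exp (2 * K * 1) - 1) := by fun_prop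
      simpa using hc.tendsto μ
    exact squeeze_zero (fun _ => dist_nonneg)
      (fun ν => truncated_riccati_dist_le (hr0 ν) (hr0 μ) (hr ν) (hr μ)) hlim
  -- For this parameter the field at `r = 0` is at least `1`, so the solution cannot become
  -- negative.
  have hlow : 0 ≤ r (-B - 1) 1 := by
    have h := image_le_of_deriv_right_lt_deriv_boundary (f := fun x => -r (-B - 1) x)
      (f' := fun x => -(V x - (-B - 1) - truncSq K (r (-B - 1) x))) (a := 0) (b := 1)
      (fun x hx => (hr _ x hx).neg.continuousWithinAt)
      (fun x hx => ((hr _ x ⟨hx.1, hx.2.le⟩).Ici_of_unit hx).neg)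
      (B := fun _ => 0) (B' := fun _ => 0) (by simp [hr0]) (fun x => hasDerivAt_const _ _)
      (fun x hx h0 => by
        rw [neg_eq_zero] at h0
        rw [h0, truncSq_eq (by simp)]
        linarith [(hB' x ⟨hx.1, hx.2.le⟩).1]) (x := 1) ⟨zero_le_one, le_rfl⟩
    linarith
  -- The discarded quadratic term has a favourable sign: `r' ≤ c`.
  have hmono : ∀ μ : ℝ, ∀ c : ℝ, (∀ x ∈ Icc (0 : ℝ) 1, V x - μ ≤ c) →
      AntitoneOn (fun x => r μ x - c * x) (Icc 0 1) := by
    intro μ c hc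
    refine antitoneOn_of_hasDerivWithinAt_nonpos (convex_Icc 0 1)
      (f' := fun x => V x - μ - truncSq K (r μ x) - c * 1) ?_ ?_ ?_
    · exact fun x hx => ((hr _ x hx).sub
        (((hasDerivWithinAt_id x _).const_mul c))).continuousWithinAt
    · exact fun x hx => ((hr _ x (interior_subset hx)).sub
        (((hasDerivWithinAt_id x _).const_mul c))).mono interior_subset
    · intro x hx
      linarith [hc x (interior_subset hx), truncSq_nonneg K (r μ x)]
  have h01 : (0 : ℝ) ∈ Icc (0 : ℝ) 1 := ⟨le_rfl, zero_le_one⟩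
  have h11 : (1 : ℝ) ∈ Icc (0 : ℝ) 1 := ⟨zero_le_one, le_rfl⟩
  have hhigh : r B 1 ≤ 0 := by
    have := hmono B 0 (fun x hx => by linarith [(hB' x hx).2]) h01 h11 zero_le_one
    simpa [hr0] using this
  obtain ⟨μ, hμ, hμ1⟩ := intermediate_value_Icc' (by linarith [B.2] : (-B - 1 : ℝ) ≤ B)
    hcont.continuousOn ⟨hhigh, hlow⟩
  simp only at hμ1
  have hle : ∀ x ∈ Icc (0 : ℝ) 1, V x - μ ≤ K := fun x hx => by
    rw [hKc]; linarith [(hB' x hx).2, hμ.1]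
  refine ⟨μ, r μ, hr0 μ, hμ1, fun x hx => ?_⟩
  -- Comparison with both zero end values gives `-K (1 - x) ≤ r x ≤ K x`; hence `|r| ≤ K` and the
  -- truncation is inactive.
  have h1 := hmono μ K hle h01 hx hx.1
  have h2 := hmono μ K hle hx h11 hx.2
  simp only [hr0, hμ1] at h1 h2
  have hK0 : (0 : ℝ) ≤ K := K.2
  have hxK : |r μ x| ≤ K := by
    rw [abs_le]; constructor <;> nlinarith [hx.1, hx.2]
  have := hr μ x hx
  rwa [truncSq_eq hxK] at this

/-- The normalized positive ground state `e`, its logarithmic derivative `r` and the lowest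
eigenvalue `lam`. -/
structure GroundStateData (V : ℝ → ℝ) where
  lam : ℝ
  r : ℝ → ℝ
  e : ℝ → ℝ
  r_zero : r 0 = 0
  r_one : r 1 = 0
  hasDeriv_r : ∀ x ∈ Icc (0 : ℝ) 1, HasDerivWithinAt r (V x - lam - r x ^ 2) (Icc 0 1) x
  cont_e : Continuous e
  e_pos : ∀ x, 0 < e x
  hasDeriv_e : ∀ x ∈ Icc (0 : ℝ) 1, HasDerivWithinAt e (r x * e x) (Icc 0 1) x
  norm_e : ∫ x in (0 : ℝ)..1, e x ^ 2 = 1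

/-- The ground state is a multiple of `exp ∫ r`, so its positivity is automatic. Extending `r`
continuously makes it continuous and positive on the whole line. -/
theorem nonempty_groundStateData {V : ℝ → ℝ} (hV : ContinuousOn V (Icc 0 1)) :
    Nonempty (GroundStateData V) := by
  obtain ⟨μ, r, h0, h1, hr⟩ := exists_riccati hV
  have hrc : ContinuousOn r (Icc 0 1) := fun x hx => (hr x hx).continuousWithinAt
  set R : ℝ → ℝ := IccExtend (zero_le_one' ℝ) ((Icc 0 1).domRestrict r) with hR
  have hRc : Continuous R := hrc.domRestrict.Icc_extend'
  have hRe : ∀ x ∈ Icc (0 : ℝ) 1, R x = r x := fun x hx => by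
    rw [hR, IccExtend_of_mem _ _ hx]; rfl
  set E : ℝ → ℝ := fun x => Real.exp (∫ y in (0 : ℝ)..x, R y) with hE
  have hEd : ∀ x, HasDerivAt E (E x * R x) x := fun x =>
    (hRc.integral_hasStrictDerivAt 0 x).hasDerivAt.exp
  have hEc : Continuous E := continuous_iff_continuousAt.2 fun x => (hEd x).continuousAt
  have hpos : 0 < ∫ x in (0 : ℝ)..1, E x ^ 2 :=
    intervalIntegral.intervalIntegral_pos_of_pos_on ((hEc.pow 2).intervalIntegrable _ _)
      (fun x _ => pow_pos (Real.exp_pos _) 2) zero_lt_one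
  set c := (Real.sqrt (∫ x in (0 : ℝ)..1, E x ^ 2))⁻¹ with hc
  have hc0 : 0 < c := inv_pos.2 (Real.sqrt_pos.2 hpos)
  refine ⟨⟨μ, r, fun x => c * E x, h0, h1, hr, by fun_prop,
    fun x => mul_pos hc0 (Real.exp_pos _), fun x hx => ?_, ?_⟩⟩
  · convert! ((hEd x).const_mul c).hasDerivWithinAt using 1
    rw [hRe x hx]; ring
  · simp only [mul_pow]
    rw [intervalIntegral.integral_const_mul, hc, inv_pow, Real.sq_sqrt hpos.le,
      inv_mul_cancel₀ hpos.ne']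

namespace GroundStateData

variable {V : ℝ → ℝ} (G : GroundStateData V)

theorem cont_r : ContinuousOn G.r (Icc 0 1) := fun x hx => (G.hasDeriv_r x hx).continuousWithinAt

end GroundStateData

/-! ### Neumann eigenfunctions and simplicity of the lowest eigenvalue -/

theorem uniqueDiffOn_unit : UniqueDiffOn ℝ (Icc (0 : ℝ) 1) := uniqueDiffOn_Icc zero_lt_one

theorem HasDerivWithinAt.derivWithin_unit {f : ℝ → ℝ} {f' x : ℝ}
    (h : HasDerivWithinAt f f' (Icc 0 1) x) (hx : x ∈ Icc (0 : ℝ) 1) :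
    _root_.derivWithin f (Icc 0 1) x = f' :=
  h.derivWithin (uniqueDiffOn_unit x hx)

theorem iteratedDerivWithin_two_unit {f f' f'' : ℝ → ℝ}
    (h : ∀ x ∈ Icc (0 : ℝ) 1, HasDerivWithinAt f (f' x) (Icc 0 1) x)
    (h' : ∀ x ∈ Icc (0 : ℝ) 1, HasDerivWithinAt f' (f'' x) (Icc 0 1) x) {x : ℝ}
    (hx : x ∈ Icc (0 : ℝ) 1) : iteratedDerivWithin 2 f (Icc 0 1) x = f'' x := by
  rw [iteratedDerivWithin_succ, iteratedDerivWithin_one]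
  rw [derivWithin_congr (fun y hy => (h y hy).derivWithin_unit hy)
    ((h x hx).derivWithin_unit hx)]
  exact (h' x hx).derivWithin_unit hx

theorem contDiffOn_two_unit {f f' f'' : ℝ → ℝ}
    (h : ∀ x ∈ Icc (0 : ℝ) 1, HasDerivWithinAt f (f' x) (Icc 0 1) x)
    (h' : ∀ x ∈ Icc (0 : ℝ) 1, HasDerivWithinAt f' (f'' x) (Icc 0 1) x)
    (hc : ContinuousOn f'' (Icc 0 1)) : ContDiffOn ℝ 2 f (Icc 0 1) := by
  rw [show (2 : WithTop ℕ∞) = 1 + 1 by norm_num, contDiffOn_succ_iff_derivWithin uniqueDiffOn_unit]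
  refine ⟨fun x hx => (h x hx).differentiableWithinAt, by simp, ?_⟩
  refine ContDiffOn.congr (f := f') ?_ fun x hx => (h x hx).derivWithin_unit hx
  rw [contDiffOn_one_iff_derivWithin uniqueDiffOn_unit]
  exact ⟨fun x hx => (h' x hx).differentiableWithinAt,
    hc.congr fun x hx => (h' x hx).derivWithin_unit hx⟩

namespace IsNeumannEigenfunction

variable {V : ℝ → ℝ} {ν : ℝ} {f : ℝ → ℝ}

theorem hasDeriv (h : IsNeumannEigenfunction V ν f) {x : ℝ} (hx : x ∈ Icc (0 : ℝ) 1) :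
    HasDerivWithinAt f (derivWithin f (Icc 0 1) x) (Icc 0 1) x :=
  (h.contDiffOn.differentiableOn (by norm_num) x hx).hasDerivWithinAt

theorem hasDeriv_deriv (h : IsNeumannEigenfunction V ν f) {x : ℝ} (hx : x ∈ Icc (0 : ℝ) 1) :
    HasDerivWithinAt (derivWithin f (Icc 0 1)) ((V x - ν) * f x) (Icc 0 1) x := by
  have h1 := h.contDiffOn.differentiableOn_iteratedDerivWithin (m := 1) (by norm_num)
    uniqueDiffOn_unit
  rw [iteratedDerivWithin_one] at h1
  have h2 := (h1 x hx).hasDerivWithinAt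
  have h3 := h.eigen x hx
  rw [iteratedDerivWithin_succ, iteratedDerivWithin_one] at h3
  convert! h2 using 1
  linarith

theorem continuousOn (h : IsNeumannEigenfunction V ν f) : ContinuousOn f (Icc 0 1) :=
  h.contDiffOn.continuousOn

end IsNeumannEigenfunction

namespace GroundStateData

variable {V : ℝ → ℝ} (G : GroundStateData V)

theorem hasDeriv_r_mul_e {x : ℝ} (hx : x ∈ Icc (0 : ℝ) 1) :
    HasDerivWithinAt (fun x => G.r x * G.e x) ((V x - G.lam) * G.e x) (Icc 0 1) x := by
  convert! (G.hasDeriv_r x hx).mul (G.hasDeriv_e x hx) using 1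
  ring

theorem isNeumannEigenfunction (hV : ContinuousOn V (Icc 0 1)) :
    IsNeumannEigenfunction V G.lam G.e := by
  have hc := G.cont_e
  have h0 : (0 : ℝ) ∈ Icc (0 : ℝ) 1 := ⟨le_rfl, zero_le_one⟩
  have h1 : (1 : ℝ) ∈ Icc (0 : ℝ) 1 := ⟨zero_le_one, le_rfl⟩
  refine ⟨contDiffOn_two_unit G.hasDeriv_e (fun x hx => G.hasDeriv_r_mul_e hx) (by fun_prop),
    fun x hx => ?_, ?_, ?_, 0, h0, (G.e_pos 0).ne'⟩
  · rw [iteratedDerivWithin_two_unit G.hasDeriv_e (fun x hx => G.hasDeriv_r_mul_e hx) hx]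
    ring
  · rw [(G.hasDeriv_e 0 h0).derivWithin_unit h0, G.r_zero, zero_mul]
  · rw [(G.hasDeriv_e 1 h1).derivWithin_unit h1, G.r_one, zero_mul]

section Wronskian

variable {ν : ℝ} {f : ℝ → ℝ}

/-- Since `r e` is the derivative of `e`, this is the Wronskian of `e` and `f`. It vanishes at both
ends by the Neumann conditions. -/
theorem hasDeriv_wronskian (h : IsNeumannEigenfunction V ν f) {x : ℝ} (hx : x ∈ Icc (0 : ℝ) 1) :
    HasDerivWithinAt (fun x => G.e x * derivWithin f (Icc 0 1) x - G.r x * G.e x * f x)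
      ((G.lam - ν) * (G.e x * f x)) (Icc 0 1) x := by
  convert! ((G.hasDeriv_e x hx).mul (h.hasDeriv_deriv hx)).sub
    ((G.hasDeriv_r_mul_e hx).mul (h.hasDeriv hx)) using 1
  ring

theorem hasDeriv_div (h : IsNeumannEigenfunction V ν f) {x : ℝ} (hx : x ∈ Icc (0 : ℝ) 1) :
    HasDerivWithinAt (fun x => f x / G.e x)
      ((G.e x * derivWithin f (Icc 0 1) x - G.r x * G.e x * f x) / G.e x ^ 2) (Icc 0 1) x := by
  convert! (h.hasDeriv hx).div (G.hasDeriv_e x hx) (G.e_pos x).ne' using 1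
  ring

/-- Let `W` be the Wronskian. Since `(f/e)' = W/e²`, integrating `W (f/e)'` by parts gives `∫ W²/e²
= (ν - lam) ∫ f²`. -/
theorem lam_le (h : IsNeumannEigenfunction V ν f) : G.lam ≤ ν := by
  have he := G.cont_e
  have hf := h.continuousOn
  have he0 : ∀ x, G.e x ≠ 0 := fun x => (G.e_pos x).ne'
  have hr := G.cont_r
  have hf' : ContinuousOn (derivWithin f (Icc 0 1)) (Icc 0 1) :=
    fun x hx => (h.hasDeriv_deriv hx).continuousWithinAt
  have hq : ContinuousOn (fun x => G.e x * derivWithin f (Icc 0 1) x - G.r x * G.e x * f x)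
    (Icc 0 1) := fun x hx => (G.hasDeriv_wronskian h hx).continuousWithinAt
  have key := integral_mul_deriv_add_deriv_mul_zero (fun x hx => G.hasDeriv_wronskian h hx)
    (fun x hx => G.hasDeriv_div h hx) (by fun_prop)
    (hq.div (by fun_prop) fun x _ => pow_ne_zero 2 (he0 x))
  simp only [h.neumann_zero, h.neumann_one, G.r_zero, G.r_one, zero_mul, mul_zero, sub_self,
    zero_sub] at key
  have e1 : ∫ x in (0 : ℝ)..1, (G.lam - ν) * (G.e x * f x) * (f x / G.e x) =
      (G.lam - ν) * ∫ x in (0 : ℝ)..1, f x ^ 2 := by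
    rw [← intervalIntegral.integral_const_mul]
    refine intervalIntegral.integral_congr fun x _ => ?_
    have := he0 x
    field_simp
  have e2 : 0 ≤ ∫ x in (0 : ℝ)..1, (G.e x * derivWithin f (Icc 0 1) x - G.r x * G.e x * f x) *
      ((G.e x * derivWithin f (Icc 0 1) x - G.r x * G.e x * f x) / G.e x ^ 2) := by
    refine intervalIntegral.integral_nonneg zero_le_one fun x _ => ?_
    rw [← mul_div_assoc]
    exact div_nonneg (mul_self_nonneg _) (sq_nonneg _)
  obtain ⟨c, hc, hc0⟩ := h.ne_zero
  have e3 : 0 < ∫ x in (0 : ℝ)..1, f x ^ 2 :=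
    intervalIntegral.integral_pos zero_lt_one (hf.pow 2) (fun x _ => sq_nonneg _)
      ⟨c, hc, by positivity⟩
  rw [e1] at key
  by_contra! hlt
  nlinarith

/-- An eigenfunction for the lowest eigenvalue is a multiple of the ground state. -/
theorem eq_const_mul (h : IsNeumannEigenfunction V G.lam f) {x : ℝ} (hx : x ∈ Icc (0 : ℝ) 1) :
    f x = f 0 / G.e 0 * G.e x := by
  -- For equal eigenvalues the Wronskian is constant, and it is zero at `0`; hence `f/e` is
  -- constant.
  have hq : ∀ y ∈ Icc (0 : ℝ) 1,
      G.e y * derivWithin f (Icc 0 1) y - G.r y * G.e y * f y = 0 := by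
    intro y hy
    have := integral_zero_eq_sub (fun x hx => G.hasDeriv_wronskian h hx)
      (by simpa using continuousOn_const) hy
    simpa [h.neumann_zero, G.r_zero] using this.symm
  have h2 := integral_zero_eq_sub (f := fun x => f x / G.e x) (f' := fun _ => 0)
    (fun y hy => by simpa [hq y hy] using G.hasDeriv_div h hy) continuousOn_const hx
  have h3 : f x / G.e x = f 0 / G.e 0 := by
    simp only [intervalIntegral.integral_zero] at h2; linarith
  rw [← h3, div_mul_cancel₀ _ (G.e_pos x).ne']

end Wronskian

theorem isPositiveGroundState (hV : ContinuousOn V (Icc 0 1)) : IsPositiveGroundState V G.e :=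
  ⟨⟨G.lam, G.isNeumannEigenfunction hV, fun _ _ h => G.lam_le h⟩, fun x _ => G.e_pos x, G.norm_e⟩

theorem eqOn_of_isPositiveGroundState (hV : ContinuousOn V (Icc 0 1)) {e : ℝ → ℝ}
    (h : IsPositiveGroundState V e) : EqOn e G.e (Icc 0 1) := by
  obtain ⟨⟨μ, hμ, hmin⟩, hpos, hnorm⟩ := h
  obtain rfl : μ = G.lam :=
    le_antisymm (hmin _ _ (G.isNeumannEigenfunction hV)) (G.lam_le hμ)
  have h0 := hpos 0 ⟨le_rfl, zero_le_one⟩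
  set k := e 0 / G.e 0 with hk
  have hk0 : 0 < k := div_pos h0 (G.e_pos 0)
  have he : ∀ x ∈ Icc (0 : ℝ) 1, e x = k * G.e x := fun x hx => G.eq_const_mul hμ hx
  have : ∫ x in (0 : ℝ)..1, e x ^ 2 = k ^ 2 * ∫ x in (0 : ℝ)..1, G.e x ^ 2 := by
    rw [← intervalIntegral.integral_const_mul]
    refine intervalIntegral.integral_congr fun x hx => ?_
    rw [uIcc_of_le zero_le_one] at hx
    simp only [he x hx]; ring
  rw [hnorm, G.norm_e, mul_one] at this
  have hk1 : k = 1 := by nlinarith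
  intro x hx
  rw [he x hx, hk1, one_mul]

end GroundStateData

/-! ### The smoothing semigroup generated by the inverse of a positive operator -/

/-- The function `s ↦ s⁻ⁿ exp(-t/s)` on `[0,∞)`, extended by zero. -/
noncomputable def heatFun (n : ℕ) (t s : ℝ) : ℝ := s⁻¹ ^ n * expNegInvGlue (s / t)

section heatFun

variable {n : ℕ} {t s : ℝ}

theorem heatFun_zero_right : heatFun n t 0 = 0 := by simp [heatFun, expNegInvGlue.zero]

theorem heatFun_of_pos (ht : 0 < t) (hs : 0 < s) :
    heatFun n t s = s⁻¹ ^ n * Real.exp (-(t / s)) := by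
  rw [heatFun, expNegInvGlue, if_neg (not_le.2 (div_pos hs ht)), inv_div]

theorem heatFun_nonneg (hs : 0 ≤ s) : 0 ≤ heatFun n t s :=
  mul_nonneg (by positivity) (expNegInvGlue.nonneg _)

/-- The flat factor beats every power of `s⁻¹` at `0`. Continuity there is essential, because `0`
may lie in the spectrum of `K`. -/
theorem continuous_heatFun (ht : 0 < t) : Continuous (heatFun n t) := by
  have h := (expNegInvGlue.continuous_polynomial_eval_inv_mul (Polynomial.X ^ n)).comp
    (continuous_id.div_const t)
  have h2 : heatFun n t = fun s => t⁻¹ ^ n *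
      ((fun x => Polynomial.eval x⁻¹ (Polynomial.X ^ n) * expNegInvGlue x) ∘ fun s => id s / t) s := by
    funext s
    simp only [heatFun, Function.comp, Polynomial.eval_pow, Polynomial.eval_X, id, inv_div,
      ← mul_assoc, ← mul_pow]
    congr 2
    field_simp
  rw [h2]
  exact continuous_const.mul h

theorem mul_heatFun_succ (hs : 0 ≤ s) : s * heatFun (n + 1) t s = heatFun n t s := by
  rcases hs.eq_or_lt with rfl | hs
  · simp [heatFun_zero_right]
  · rw [heatFun, heatFun, pow_succ']
    field_simp

theorem abs_exp_sub_one_sub_self_le (z : ℝ) :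
    |Real.exp z - 1 - z| ≤ |z| ^ 2 * Real.exp |z| := by
  have h := Complex.norm_exp_sub_sum_le_norm_mul_exp (z : ℂ) 2
  simp only [Finset.sum_range_succ, Finset.sum_range_zero, pow_zero, pow_one, Nat.factorial,
    zero_add, Nat.cast_one, div_one, mul_one, Complex.norm_real, Real.norm_eq_abs] at h
  rw [← Real.norm_eq_abs, ← Complex.norm_real]
  push_cast
  rwa [sub_sub]

/-- Use the second-order remainder of `exp` at `-h/s`. Half of the decay `exp (-t/s)` absorbs the
growth `exp (|h|/s)`, and the factor `s⁻²` raises the index by two. The resulting bound is uniform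
on the spectrum. -/
theorem abs_heatFun_taylor_le {h : ℝ} (ht : 0 < t) (hs : 0 ≤ s) (hh : |h| ≤ t / 2) :
    |heatFun n (t + h) s - heatFun n t s + h * heatFun (n + 1) t s| ≤
      h ^ 2 * heatFun (n + 2) (t / 2) s := by
  rcases hs.eq_or_lt with rfl | hs
  · simp [heatFun_zero_right]
  have hth : 0 < t + h := by linarith [(abs_le.1 hh).1]
  rw [heatFun_of_pos hth hs, heatFun_of_pos ht hs, heatFun_of_pos ht hs,
    heatFun_of_pos (half_pos ht) hs]
  have e1 : Real.exp (-((t + h) / s)) = Real.exp (-(t / s)) * Real.exp (-(h / s)) := by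
    rw [← Real.exp_add]; ring_nf
  have e2 : s⁻¹ ^ n * Real.exp (-((t + h) / s)) - s⁻¹ ^ n * Real.exp (-(t / s)) +
      h * (s⁻¹ ^ (n + 1) * Real.exp (-(t / s))) =
      s⁻¹ ^ n * Real.exp (-(t / s)) * (Real.exp (-(h / s)) - 1 - -(h / s)) := by
    rw [e1, pow_succ]; ring
  have hp : 0 ≤ s⁻¹ ^ n * Real.exp (-(t / s)) := by positivity
  rw [e2, abs_mul, abs_of_nonneg hp]
  refine (mul_le_mul_of_nonneg_left (abs_exp_sub_one_sub_self_le _) hp).trans ?_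
  have e3 : |-(h / s)| = |h| / s := by rw [abs_neg, abs_div, abs_of_pos hs]
  have e4 : Real.exp (-(t / s)) * Real.exp (|h| / s) ≤ Real.exp (-(t / 2 / s)) := by
    rw [← Real.exp_add, Real.exp_le_exp]
    have := div_le_div_of_nonneg_right hh hs.le
    have e5 : t / s = t / 2 / s + t / 2 / s := by ring
    rw [e5]; linarith
  rw [e3]
  calc s⁻¹ ^ n * Real.exp (-(t / s)) * ((|h| / s) ^ 2 * Real.exp (|h| / s))
      = h ^ 2 * (s⁻¹ ^ (n + 2) * (Real.exp (-(t / s)) * Real.exp (|h| / s))) := by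
        rw [div_pow, sq_abs, pow_add, inv_pow s 2]; ring
    _ ≤ _ := by gcongr

theorem heatFun_zero_le (ht : 0 < t) {b : ℝ} (hs : 0 ≤ s) (hb : s ≤ b) :
    heatFun 0 t s ≤ Real.exp (-(t / b)) := by
  rcases hs.eq_or_lt with rfl | hs
  · rw [heatFun_zero_right]; positivity
  · rw [heatFun_of_pos ht hs, pow_zero, one_mul]
    gcongr

theorem heatFun_zero_le_one (ht : 0 < t) (hs : 0 ≤ s) : heatFun 0 t s ≤ 1 :=
  (heatFun_zero_le ht hs le_rfl).trans (Real.exp_le_one_iff.2 (by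
    have : 0 ≤ t / s := by positivity
    linarith))

/-- From `1 - exp (-y) ≤ y` with `y = t/s`: the extra factor `s` makes convergence as `t → 0`
uniform, at a linear rate. -/
theorem abs_mul_heatFun_zero_sub_le (ht : 0 < t) (hs : 0 ≤ s) : |s * heatFun 0 t s - s| ≤ t := by
  rcases hs.eq_or_lt with rfl | hs'
  · simpa using ht.le
  · have h1 := heatFun_zero_le_one ht hs
    have h2 := Real.add_one_le_exp (-(t / s))
    rw [heatFun_of_pos ht hs', pow_zero, one_mul] at *
    rw [abs_le]
    have h3 : s * (t / s) = t := by field_simp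
    constructor <;> nlinarith

end heatFun

section orbit

variable {H : Type*} [NormedAddCommGroup H] [InnerProductSpace ℂ H] [CompleteSpace H]
  {K : H →L[ℂ] H}

/-- The operators `K⁻ⁿ exp(-t K⁻¹)`. -/
noncomputable def heatOp (K : H →L[ℂ] H) (n : ℕ) (t : ℝ) : H →L[ℂ] H := cfc (heatFun n t) K

theorem mul_heatOp_succ (hK : 0 ≤ K) (n : ℕ) {t : ℝ} (ht : 0 < t) :
    K * heatOp K (n + 1) t = heatOp K n t := by
  have hsa : IsSelfAdjoint K := IsSelfAdjoint.of_nonneg hK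
  have hc := continuous_heatFun (n := n + 1) ht
  have h1 : cfc (fun s => s * heatFun (n + 1) t s) K = K * heatOp K (n + 1) t := by
    rw [cfc_mul (fun s : ℝ => s) (heatFun (n + 1) t) K (by fun_prop) hc.continuousOn,
      cfc_id' ℝ K]
    rfl
  rw [← h1]
  exact cfc_congr fun s hs => mul_heatFun_succ (spectrum_nonneg_of_nonneg hK hs)

/-- The scalar Taylor estimate passes through the functional calculus, giving differentiability in
operator norm: the remainder function is bounded on the compact spectrum. -/
theorem hasDerivAt_heatOp (hK : 0 ≤ K) (n : ℕ) {t : ℝ} (ht : 0 < t) :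
    HasDerivAt (heatOp K n) (-heatOp K (n + 1) t) t := by
  have hsa : IsSelfAdjoint K := IsSelfAdjoint.of_nonneg hK
  obtain ⟨M, hM⟩ := (spectrum.isCompact (𝕜 := ℝ) K).exists_bound_of_continuousOn
    (continuous_heatFun (n := n + 2) (half_pos ht)).continuousOn
  rw [hasDerivAt_iff_isLittleO_nhds_zero]
  refine Asymptotics.IsBigO.trans_isLittleO (g := fun h : ℝ => h ^ 2) ?_ ?_
  · refine Asymptotics.IsBigO.of_bound (max M 0) ?_
    have hev : ∀ᶠ h : ℝ in 𝓝 0, |h| ≤ t / 2 := by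
      have := Metric.closedBall_mem_nhds (0 : ℝ) (half_pos ht)
      filter_upwards [this] with h hh
      simpa using hh
    filter_upwards [hev] with h hh
    have hth : 0 < t + h := by linarith [(abs_le.1 hh).1]
    have c1 := continuous_heatFun (n := n) hth
    have c2 := continuous_heatFun (n := n) ht
    have c3 := continuous_heatFun (n := n + 1) ht
    have e : heatOp K n (t + h) - heatOp K n t - h • -heatOp K (n + 1) t =
        cfc (fun s => heatFun n (t + h) s - heatFun n t s + h * heatFun (n + 1) t s) K := by
      rw [cfc_add K (fun s => heatFun n (t + h) s - heatFun n t s)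
          (fun s => h * heatFun (n + 1) t s) (c1.sub c2).continuousOn (by fun_prop),
        cfc_sub (heatFun n (t + h)) (heatFun n t) K c1.continuousOn c2.continuousOn,
        cfc_const_mul h (heatFun (n + 1) t) K c3.continuousOn]
      simp only [heatOp, smul_neg, sub_neg_eq_add]
    rw [e]
    refine norm_cfc_le (by positivity) fun s hs => ?_
    have hs0 : 0 ≤ s := spectrum_nonneg_of_nonneg hK hs
    refine (abs_heatFun_taylor_le ht hs0 hh).trans ?_
    rw [Real.norm_of_nonneg (sq_nonneg h), mul_comm]
    gcongr
    exact le_max_of_le_left ((le_abs_self _).trans (hM s hs))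
  · simpa using Asymptotics.isLittleO_pow_id (𝕜 := ℝ) one_lt_two

/-- Boundedness of `K` is a spectral gap for `K⁻¹`. The factor `‖1‖` allows for the trivial space.
-/
theorem norm_heatOp_zero_le (hK : 0 ≤ K) {t : ℝ} (ht : 0 < t) :
    ‖heatOp K 0 t‖ ≤ Real.exp (-(t / (‖K‖ * ‖(1 : H →L[ℂ] H)‖))) := by
  refine norm_cfc_le (Real.exp_pos _).le fun s hs => ?_
  have hs0 : 0 ≤ s := spectrum_nonneg_of_nonneg hK hs
  rw [Real.norm_of_nonneg (heatFun_nonneg hs0)]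
  refine heatFun_zero_le ht hs0 ((le_abs_self s).trans ?_)
  exact spectrum.norm_le_norm_mul_of_mem hs

theorem norm_heatOp_zero_le_one (hK : 0 ≤ K) {t : ℝ} (ht : 0 < t) : ‖heatOp K 0 t‖ ≤ 1 :=
  (norm_heatOp_zero_le hK ht).trans (Real.exp_le_one_iff.2 (by
    have : 0 ≤ t / (‖K‖ * ‖(1 : H →L[ℂ] H)‖) := by positivity
    linarith))

theorem norm_heatOp_zero_mul_sub_le (hK : 0 ≤ K) {t : ℝ} (ht : 0 < t) :
    ‖heatOp K 0 t * K - K‖ ≤ t := by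
  have hsa : IsSelfAdjoint K := IsSelfAdjoint.of_nonneg hK
  have hc := continuous_heatFun (n := 0) ht
  have e : cfc (fun s => heatFun 0 t s * s - s) K = heatOp K 0 t * K - K := by
    rw [cfc_sub (fun s => heatFun 0 t s * s) (fun s => s) K (by fun_prop) (by fun_prop),
      cfc_mul (heatFun 0 t) (fun s : ℝ => s) K hc.continuousOn (by fun_prop), cfc_id' ℝ K]
    rfl
  rw [← e]
  refine norm_cfc_le ht.le fun s hs => ?_
  rw [mul_comm]
  exact abs_mul_heatFun_zero_sub_le ht (spectrum_nonneg_of_nonneg hK hs)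

/-- Convergence is linear in `t` on the range of `K`, which is dense by injectivity and
self-adjointness; contractivity extends it to all vectors. -/
theorem tendsto_heatOp_zero_nhdsGT (hK : 0 ≤ K) (hinj : ∀ x, K x = 0 → x = 0) (w : H) :
    Tendsto (fun t => heatOp K 0 t w) (𝓝[>] 0) (𝓝 w) := by
  have hsa : IsSelfAdjoint K := IsSelfAdjoint.of_nonneg hK
  have hdense : Dense (K.range : Set H) := by
    rw [Submodule.dense_iff_topologicalClosure_eq_top, Submodule.topologicalClosure_eq_top_iff,
      Submodule.eq_bot_iff]
    intro x hx
    refine hinj x ?_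
    rw [← inner_self_eq_zero (𝕜 := ℂ)]
    -- Testing against `K (K x)` gives `‖K x‖² = 0`.
    have h1 := (Submodule.mem_orthogonal _ x).1 hx (K (K x)) ⟨K x, rfl⟩
    rwa [← ContinuousLinearMap.adjoint_inner_right, hsa.adjoint_eq] at h1
  rw [Metric.tendsto_nhds]
  intro ε hε
  obtain ⟨_, ⟨y, rfl⟩, hv⟩ := hdense.exists_dist_lt w (show 0 < ε / 3 by positivity)
  have hy : ∀ᶠ t : ℝ in 𝓝[>] 0, t * ‖y‖ < ε / 3 := by
    have : Tendsto (fun t : ℝ => t * ‖y‖) (𝓝[>] 0) (𝓝 (0 * ‖y‖)) :=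
      ((continuous_id.mul continuous_const).tendsto 0).mono_left nhdsWithin_le_nhds
    rw [zero_mul] at this
    exact this.eventually_lt_const (by positivity)
  filter_upwards [hy, self_mem_nhdsWithin] with t h1 (ht : 0 < t)
  have h2 : ‖heatOp K 0 t (w - K y)‖ ≤ dist w (K y) := by
    rw [dist_eq_norm]
    exact (ContinuousLinearMap.le_of_opNorm_le _ (norm_heatOp_zero_le_one hK ht) _).trans
      (one_mul _).le
  have h3 : ‖(heatOp K 0 t * K - K) y‖ ≤ t * ‖y‖ :=
    ContinuousLinearMap.le_of_opNorm_le _ (norm_heatOp_zero_mul_sub_le hK ht) _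
  have e : heatOp K 0 t w - w =
      heatOp K 0 t (w - K y) + (heatOp K 0 t * K - K) y - (w - K y) := by
    simp only [map_sub, sub_apply, mul_apply_eq_comp]
    abel
  rw [dist_eq_norm, e]
  calc _ ≤ ‖heatOp K 0 t (w - K y)‖ + ‖(heatOp K 0 t * K - K) y‖ + ‖w - K y‖ :=
        (norm_sub_le _ _).trans (by gcongr; exact norm_add_le _ _)
    _ < ε / 3 + ε / 3 + ε / 3 := by
        rw [← dist_eq_norm w (K y)]
        have hv' : dist w (K y) < ε / 3 := hv
        gcongr
        · exact h2.trans_lt hv'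
        · exact h3.trans_lt h1
    _ = ε := by ring

/-- For an injective positive operator `K`, every orbit of the semigroup generated by `-K⁻¹` is
smooth for positive times, with values in the range of all powers of `K`. -/
theorem exists_smoothing_orbit (hK : 0 ≤ K) (hinj : ∀ x, K x = 0 → x = 0) (w : H) :
    ∃ h : ℕ → ℝ → H, (∀ n, ∀ t > 0, K (h (n + 1) t) = h n t) ∧
      (∀ n, ∀ t > 0, HasDerivAt (h n) (-h (n + 1) t) t) ∧
      Tendsto (h 0) (𝓝[>] 0) (𝓝 w) ∧ Tendsto (h 0) atTop (𝓝 0) := by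
  refine ⟨fun n t => heatOp K n t w, fun n t ht => ?_, fun n t ht => ?_,
    tendsto_heatOp_zero_nhdsGT hK hinj w, ?_⟩
  · exact congrArg (fun T : H →L[ℂ] H => T w) (mul_heatOp_succ hK n ht)
  · exact ((ContinuousLinearMap.apply ℂ H w).restrictScalars ℝ).hasFDerivAt.comp_hasDerivAt t
      (hasDerivAt_heatOp hK n ht)
  · set b := ‖K‖ * ‖(1 : H →L[ℂ] H)‖ with hb
    -- If `b = 0`, either `K` or the identity vanishes, and both force `w = 0`.
    rcases (show 0 ≤ b by positivity).eq_or_lt with hb0 | hb0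
    · have hw : w = 0 := by
        rw [hb, eq_comm, mul_eq_zero, norm_eq_zero, norm_eq_zero] at hb0
        rcases hb0 with h | h
        · exact hinj w (by rw [h]; rfl)
        · exact congrArg (fun T : H →L[ℂ] H => T w) h
      simp [hw]
    · have hlim : Tendsto (fun t : ℝ => Real.exp (-(t / b)) * ‖w‖) atTop (𝓝 0) := by
        have := (Real.tendsto_exp_neg_atTop_nhds_zero.comp
          (tendsto_id.atTop_div_const hb0)).mul_const ‖w‖
        simpa using this
      refine squeeze_zero_norm' ?_ hlim
      filter_upwards [eventually_gt_atTop 0] with t ht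
      exact ContinuousLinearMap.le_of_opNorm_le _ (norm_heatOp_zero_le hK ht) _

end orbit

/-! ### Bounded families of continuous functions depending linearly on an `L²` function -/

/-- The Hilbert space `L²([0,1])` of complex-valued functions. -/
abbrev L2C : Type := Lp ℂ 2 (volume.restrict (Icc (0 : ℝ) 1))

theorem integrableOn_of_Lp_two {E : Type*} [NormedAddCommGroup E]
    (f : Lp E 2 (volume.restrict (Icc (0 : ℝ) 1))) :
    IntegrableOn f (Icc 0 1) := (Lp.memLp f).integrable (by norm_num)

theorem integral_norm_le_norm {E : Type*} [NormedAddCommGroup E]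
    (f : Lp E 2 (volume.restrict (Icc (0 : ℝ) 1))) :
    ∫ x in Icc (0 : ℝ) 1, ‖f x‖ ≤ ‖f‖ := by
  have : IsProbabilityMeasure (volume.restrict (Icc (0 : ℝ) 1)) := ⟨by simp⟩
  have h := eLpNorm_le_eLpNorm_of_exponent_le (p := 1) (q := 2) (by norm_num)
    (Lp.aestronglyMeasurable f)
  rw [Lp.norm_def, integral_norm_eq_lintegral_enorm (Lp.aestronglyMeasurable f),
    ← eLpNorm_one_eq_lintegral_enorm]
  exact ENNReal.toReal_mono (Lp.eLpNorm_ne_top f) h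

/-- The map `F` associates linearly and boundedly to any `f ∈ L²` a continuous function on
`[0,1]`. -/
structure IsBoundedFamily (F : L2C → ℝ → ℂ) : Prop where
  add : ∀ f g, ∀ x ∈ Icc (0 : ℝ) 1, F (f + g) x = F f x + F g x
  smul : ∀ (c : ℂ) f, ∀ x ∈ Icc (0 : ℝ) 1, F (c • f) x = c * F f x
  bound : ∃ C, 0 ≤ C ∧ ∀ f, ∀ x ∈ Icc (0 : ℝ) 1, ‖F f x‖ ≤ C * ‖f‖
  cont : ∀ f, ContinuousOn (F f) (Icc 0 1)

theorem integrableOn_mul_Lp {g : ℝ → ℂ} (hg : ContinuousOn g (Icc 0 1)) (f : L2C) :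
    IntegrableOn (fun x => g x * f x) (Icc 0 1) :=
  IntegrableOn.continuousOn_mul hg (integrableOn_of_Lp_two f) isCompact_Icc

theorem MeasureTheory.IntegrableOn.intervalIntegrable_unit {E : Type*} [NormedAddCommGroup E]
    {f : ℝ → E} (hf : IntegrableOn f (Icc 0 1)) {a b : ℝ} (ha : a ∈ Icc (0 : ℝ) 1)
    (hb : b ∈ Icc (0 : ℝ) 1) : IntervalIntegrable f volume a b := by
  rw [intervalIntegrable_iff]
  exact hf.mono_set (uIoc_subset_uIcc.trans (uIcc_subset_Icc ha hb))

theorem ae_eq_of_Icc {E : Type*} {f g : ℝ → E} {x : ℝ} (hx : x ∈ Icc (0 : ℝ) 1)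
    (h : f =ᵐ[volume.restrict (Icc (0 : ℝ) 1)] g) :
    ∀ᵐ y, y ∈ uIoc 0 x → f y = g y := by
  rw [EventuallyEq, ae_restrict_iff' measurableSet_Icc] at h
  filter_upwards [h] with y hy hy'
  exact hy (uIcc_zero_subset_Icc hx (uIoc_subset_uIcc hy'))

theorem zero_mem_unit : (0 : ℝ) ∈ Icc (0 : ℝ) 1 := ⟨le_rfl, zero_le_one⟩

theorem one_mem_unit : (1 : ℝ) ∈ Icc (0 : ℝ) 1 := ⟨zero_le_one, le_rfl⟩

namespace IsBoundedFamily

/-- The weighted primitive `f ↦ ∫₀ˣ g f`. -/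
theorem primitive {g : ℝ → ℂ} (hg : ContinuousOn g (Icc 0 1)) :
    IsBoundedFamily fun f x => ∫ y in (0 : ℝ)..x, g y * f y where
  add f₁ f₂ x hx := by
    rw [← intervalIntegral.integral_add
      ((integrableOn_mul_Lp hg f₁).intervalIntegrable_unit zero_mem_unit hx)
      ((integrableOn_mul_Lp hg f₂).intervalIntegrable_unit zero_mem_unit hx)]
    refine intervalIntegral.integral_congr_ae ?_
    filter_upwards [ae_eq_of_Icc hx (Lp.coeFn_add f₁ f₂)] with y hy hy'
    rw [hy hy', Pi.add_apply, mul_add]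
  smul c f x hx := by
    rw [← intervalIntegral.integral_const_mul]
    refine intervalIntegral.integral_congr_ae ?_
    filter_upwards [ae_eq_of_Icc hx (Lp.coeFn_smul c f)] with y hy hy'
    rw [hy hy', Pi.smul_apply, smul_eq_mul]; ring
  bound := by
    obtain ⟨C, hC⟩ := isCompact_Icc.exists_bound_of_continuousOn hg
    have hC0 : 0 ≤ C := (norm_nonneg _).trans (hC 0 zero_mem_unit)
    refine ⟨C, hC0, fun f x hx => ?_⟩
    have hf := (integrableOn_of_Lp_two f).norm
    calc ‖∫ y in (0 : ℝ)..x, g y * f y‖ ≤ ∫ y in Ioc 0 x, ‖g y * f y‖ := by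
          rw [intervalIntegral.integral_of_le hx.1]; exact norm_integral_le_integral_norm _
      _ ≤ ∫ y in Icc 0 1, ‖g y * f y‖ :=
          setIntegral_mono_set (integrableOn_mul_Lp hg f).norm
            (Eventually.of_forall fun y => norm_nonneg _)
            (Ioc_subset_Icc_self.trans (Icc_subset_Icc_right hx.2)).eventuallyLE
      _ ≤ ∫ y in Icc 0 1, C * ‖f y‖ := by
          refine setIntegral_mono_on (integrableOn_mul_Lp hg f).norm (hf.const_mul C)
            measurableSet_Icc fun y hy => ?_
          rw [norm_mul]
          gcongr
          exact hC y hy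
      _ ≤ C * ‖f‖ := by
          rw [integral_const_mul]
          gcongr
          exact integral_norm_le_norm f
  cont f := by
    have := intervalIntegral.continuousOn_primitive_interval (a := 0) (b := 1)
      (f := fun y => g y * f y) (μ := volume)
    rw [uIcc_of_le zero_le_one] at this
    exact this (integrableOn_mul_Lp hg f)

variable {F : L2C → ℝ → ℂ}

theorem mul_left (hF : IsBoundedFamily F) {g : ℝ → ℂ} (hg : ContinuousOn g (Icc 0 1)) :
    IsBoundedFamily fun f x => g x * F f x where
  add f₁ f₂ x hx := by rw [hF.add _ _ x hx, mul_add]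
  smul c f x hx := by rw [hF.smul _ _ x hx]; ring
  bound := by
    obtain ⟨C, hC⟩ := isCompact_Icc.exists_bound_of_continuousOn hg
    obtain ⟨D, hD0, hD⟩ := hF.bound
    have hC0 : 0 ≤ C := (norm_nonneg _).trans (hC 0 zero_mem_unit)
    refine ⟨C * D, mul_nonneg hC0 hD0, fun f x hx => ?_⟩
    rw [norm_mul, mul_assoc]
    gcongr
    · exact hC x hx
    · exact hD f x hx
  cont f := hg.mul (hF.cont f)

theorem integral (hF : IsBoundedFamily F) :
    IsBoundedFamily fun f x => ∫ y in (0 : ℝ)..x, F f y where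
  add f₁ f₂ x hx := by
    rw [← intervalIntegral.integral_add ((hF.cont f₁).intervalIntegrable_zero hx)
      ((hF.cont f₂).intervalIntegrable_zero hx)]
    exact intervalIntegral.integral_congr fun y hy => hF.add _ _ y (uIcc_zero_subset_Icc hx hy)
  smul c f x hx := by
    rw [← intervalIntegral.integral_const_mul]
    exact intervalIntegral.integral_congr fun y hy => hF.smul _ _ y (uIcc_zero_subset_Icc hx hy)
  bound := by
    obtain ⟨D, hD0, hD⟩ := hF.bound
    refine ⟨D, hD0, fun f x hx => ?_⟩
    refine (intervalIntegral.norm_integral_le_of_norm_le_const (C := D * ‖f‖) fun y hy =>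
      hD f y (uIcc_zero_subset_Icc hx (uIoc_subset_uIcc hy))).trans ?_
    rw [sub_zero, abs_of_nonneg hx.1]
    exact mul_le_of_le_one_right (by positivity) hx.2
  cont f x hx := (hasDerivWithinAt_integral_zero (hF.cont f) hx).continuousWithinAt

theorem eval_one (hF : IsBoundedFamily F) : IsBoundedFamily fun f _ => F f 1 where
  add f₁ f₂ _ _ := hF.add _ _ 1 one_mem_unit
  smul c f _ _ := hF.smul _ _ 1 one_mem_unit
  bound := by
    obtain ⟨D, hD0, hD⟩ := hF.bound
    exact ⟨D, hD0, fun f _ _ => hD f 1 one_mem_unit⟩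
  cont _ := continuousOn_const

theorem sub {F' : L2C → ℝ → ℂ} (hF : IsBoundedFamily F) (hF' : IsBoundedFamily F') :
    IsBoundedFamily fun f x => F f x - F' f x where
  add f₁ f₂ x hx := by rw [hF.add _ _ x hx, hF'.add _ _ x hx]; ring
  smul c f x hx := by rw [hF.smul _ _ x hx, hF'.smul _ _ x hx]; ring
  bound := by
    obtain ⟨C, hC0, hC⟩ := hF.bound
    obtain ⟨D, hD0, hD⟩ := hF'.bound
    refine ⟨C + D, add_nonneg hC0 hD0, fun f x hx => ?_⟩
    rw [add_mul]
    exact (norm_sub_le _ _).trans (add_le_add (hC f x hx) (hD f x hx))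
  cont f := (hF.cont f).sub (hF'.cont f)

theorem neg (hF : IsBoundedFamily F) {x : ℝ} (hx : x ∈ Icc (0 : ℝ) 1) (f : L2C) :
    F (-f) x = -F f x := by
  have := hF.smul (-1) f x hx
  rwa [neg_one_smul, neg_one_mul] at this

theorem map_sub (hF : IsBoundedFamily F) {x : ℝ} (hx : x ∈ Icc (0 : ℝ) 1) (f g : L2C) :
    F (f - g) x = F f x - F g x := by
  rw [sub_eq_add_neg, hF.add _ _ x hx, hF.neg hx, sub_eq_add_neg]

/-- Evaluation at a point, as a continuous linear functional. -/
theorem exists_eval (hF : IsBoundedFamily F) {x : ℝ} (hx : x ∈ Icc (0 : ℝ) 1) :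
    ∃ L : L2C →L[ℂ] ℂ, ∀ f, L f = F f x := by
  obtain ⟨C, _, hC⟩ := hF.bound
  exact ⟨LinearMap.mkContinuous ⟨⟨fun f => F f x, fun f g => hF.add f g x hx⟩,
    fun c f => hF.smul c f x hx⟩ C fun f => hC f x hx, fun f => rfl⟩

theorem hasDerivAt (hF : IsBoundedFamily F) {x : ℝ} (hx : x ∈ Icc (0 : ℝ) 1) {h : ℝ → L2C}
    {h' : L2C} {t : ℝ} (hh : HasDerivAt h h' t) :
    HasDerivAt (fun τ => F (h τ) x) (F h' x) t := by
  obtain ⟨L, hL⟩ := hF.exists_eval hx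
  simp only [← hL]
  exact (L.restrictScalars ℝ).hasFDerivAt.comp_hasDerivAt t hh

/-- The bound is uniform in `x`, so the variation in time is controlled independently of the point;
a fixed function is continuous in `x`. -/
theorem continuousOn_uncurry (hF : IsBoundedFamily F) {h : ℝ → L2C} {s : Set ℝ}
    (hh : ContinuousOn h s) :
    ContinuousOn (fun p : ℝ × ℝ => F (h p.1) p.2) (s ×ˢ Icc 0 1) := by
  obtain ⟨C, hC0, hC⟩ := hF.bound
  rintro ⟨t, x⟩ ⟨ht, hx⟩
  simp only at ht hx
  have h1 : Tendsto (fun p : ℝ × ℝ => C * ‖h p.1 - h t‖ + ‖F (h t) p.2 - F (h t) x‖)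
      (𝓝[s ×ˢ Icc 0 1] (t, x)) (𝓝 (C * ‖h t - h t‖ + ‖F (h t) x - F (h t) x‖)) := by
    refine ((Tendsto.norm (Tendsto.sub_const ?_ _)).const_mul C).add
      (Tendsto.norm (Tendsto.sub_const ?_ _))
    · exact (hh t ht).tendsto.comp (tendsto_fst.mono_left
        (by rw [nhdsWithin_prod_eq]) )
    · exact (hF.cont (h t) x hx).tendsto.comp (tendsto_snd.mono_left
        (by rw [nhdsWithin_prod_eq]))
  simp only [sub_self, norm_zero, mul_zero, add_zero] at h1
  rw [ContinuousWithinAt, tendsto_iff_norm_sub_tendsto_zero]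
  refine squeeze_zero' (Eventually.of_forall fun _ => norm_nonneg _) ?_ h1
  filter_upwards [self_mem_nhdsWithin] with p hp
  calc ‖F (h p.1) p.2 - F (h t) x‖
      = ‖F (h p.1 - h t) p.2 + (F (h t) p.2 - F (h t) x)‖ := by
        rw [hF.map_sub hp.2]; congr 1; ring
    _ ≤ _ := (norm_add_le _ _).trans (by gcongr; exact hC _ _ hp.2)

theorem memLp (hF : IsBoundedFamily F) (f : L2C) :
    MemLp (F f) 2 (volume.restrict (Icc (0 : ℝ) 1)) := by
  obtain ⟨C, _, hC⟩ := hF.bound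
  refine MemLp.of_bound ((hF.cont f).aestronglyMeasurable measurableSet_Icc) (C * ‖f‖) ?_
  exact (ae_restrict_iff' measurableSet_Icc).2 (Eventually.of_forall fun x hx => hC f x hx)

theorem exists_toLp (hF : IsBoundedFamily F) :
    ∃ L : L2C →L[ℂ] L2C, ∀ f, L f =ᵐ[volume.restrict (Icc (0 : ℝ) 1)] F f := by
  obtain ⟨C, hC0, hC⟩ := hF.bound
  refine ⟨LinearMap.mkContinuous ⟨⟨fun f => (hF.memLp f).toLp _, fun f g => ?_⟩, fun c f => ?_⟩ C
    fun f => ?_, fun f => MemLp.coeFn_toLp (hF.memLp f)⟩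
  · rw [← MemLp.toLp_add, MemLp.toLp_eq_toLp_iff]
    exact (ae_restrict_iff' measurableSet_Icc).2 (Eventually.of_forall (hF.add f g))
  · rw [RingHom.id_apply, ← MemLp.toLp_const_smul, MemLp.toLp_eq_toLp_iff]
    exact (ae_restrict_iff' measurableSet_Icc).2 (Eventually.of_forall (hF.smul c f))
  · have h := Lp.norm_le_of_ae_bound (p := 2) (f := (hF.memLp f).toLp _) (C := C * ‖f‖)
      (by positivity) (by
        filter_upwards [MemLp.coeFn_toLp (hF.memLp f), ae_restrict_mem measurableSet_Icc]
          with x hx hx'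
        rw [hx]; exact hC f x hx')
    simpa [measureUnivNNReal] using h

end IsBoundedFamily

/-! ### Integration by parts -/

/-- Fubini on the triangle `y ≤ x`, so integrability of `G` suffices. -/
theorem integral_mul_primitive {q G : ℝ → ℂ} (hq : IntegrableOn q (Icc 0 1))
    (hG : IntegrableOn G (Icc 0 1)) :
    ∫ x in (0 : ℝ)..1, q x * ∫ y in (0 : ℝ)..x, G y =
      ∫ y in (0 : ℝ)..1, (∫ x in y..1, q x) * G y := by
  set μ := volume.restrict (Icc (0 : ℝ) 1) with hμ
  have hS : MeasurableSet {p : ℝ × ℝ | p.2 ≤ p.1} := measurableSet_le measurable_snd measurable_fst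
  have hint : Integrable ({p : ℝ × ℝ | p.2 ≤ p.1}.indicator fun p => q p.1 * G p.2) (μ.prod μ) :=
    (Integrable.mul_prod hq hG).indicator hS
  have hswap := integral_integral_swap (f := fun x y =>
    {p : ℝ × ℝ | p.2 ≤ p.1}.indicator (fun p => q p.1 * G p.2) (x, y)) (μ := μ) (ν := μ) hint
  have e1 : ∀ x ∈ Icc (0 : ℝ) 1, ∫ y, {p : ℝ × ℝ | p.2 ≤ p.1}.indicator
      (fun p => q p.1 * G p.2) (x, y) ∂μ = q x * ∫ y in (0 : ℝ)..x, G y := by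
    intro x hx
    have : (fun y => {p : ℝ × ℝ | p.2 ≤ p.1}.indicator (fun p => q p.1 * G p.2) (x, y)) =
        (Iic x).indicator fun y => q x * G y := by
      funext y; simp only [indicator, mem_ofPred_eq, mem_Iic]
    rw [this, hμ, setIntegral_indicator measurableSet_Iic, integral_const_mul,
      intervalIntegral.integral_of_le hx.1, ← integral_Icc_eq_integral_Ioc]
    congr 3
    ext y
    simp only [mem_inter_iff, mem_Icc, mem_Iic]
    exact ⟨fun h => ⟨h.1.1, h.2⟩, fun h => ⟨⟨h.1, h.2.trans hx.2⟩, h.2⟩⟩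
  have e2 : ∀ y ∈ Icc (0 : ℝ) 1, ∫ x, {p : ℝ × ℝ | p.2 ≤ p.1}.indicator
      (fun p => q p.1 * G p.2) (x, y) ∂μ = (∫ x in y..1, q x) * G y := by
    intro y hy
    have : (fun x => {p : ℝ × ℝ | p.2 ≤ p.1}.indicator (fun p => q p.1 * G p.2) (x, y)) =
        (Ici y).indicator fun x => q x * G y := by
      funext x; simp only [indicator, mem_ofPred_eq, mem_Ici]
    rw [this, hμ, setIntegral_indicator measurableSet_Ici, integral_mul_const,
      intervalIntegral.integral_of_le hy.2, ← integral_Icc_eq_integral_Ioc]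
    congr 3
    ext x
    simp only [mem_inter_iff, mem_Icc, mem_Ici]
    exact ⟨fun h => ⟨h.2, h.1.2⟩, fun h => ⟨⟨hy.1.trans h.1, h.2⟩, h.1⟩⟩
  rw [intervalIntegral.integral_of_le zero_le_one, intervalIntegral.integral_of_le zero_le_one,
    ← integral_Icc_eq_integral_Ioc, ← integral_Icc_eq_integral_Ioc,
    ← setIntegral_congr_fun measurableSet_Icc e1, ← setIntegral_congr_fun measurableSet_Icc e2]
  exact hswap

/-- Integration by parts against the primitive of an integrable function. -/
theorem integral_mul_eq_neg_integral_deriv_mul_primitive {Q q G : ℝ → ℂ}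
    (hQ : ∀ x ∈ Icc (0 : ℝ) 1, HasDerivWithinAt Q (q x) (Icc 0 1) x)
    (hq : ContinuousOn q (Icc 0 1)) (hQ1 : Q 1 = 0) (hG : IntegrableOn G (Icc 0 1)) :
    ∫ x in (0 : ℝ)..1, Q x * G x = -∫ x in (0 : ℝ)..1, q x * ∫ y in (0 : ℝ)..x, G y := by
  have hqi : IntegrableOn q (Icc 0 1) := hq.integrableOn_compact isCompact_Icc
  rw [integral_mul_primitive hqi hG, ← intervalIntegral.integral_neg]
  refine intervalIntegral.integral_congr fun y hy => ?_
  rw [uIcc_of_le zero_le_one] at hy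
  have e1 := integral_zero_eq_sub hQ hq hy
  have e2 := integral_zero_eq_sub hQ hq one_mem_unit
  have e3 := intervalIntegral.integral_interval_sub_left
    (hqi.intervalIntegrable_unit zero_mem_unit one_mem_unit)
    (hqi.intervalIntegrable_unit zero_mem_unit hy)
  rw [← e3, e1, e2, hQ1]
  ring

/-- Lebesgue differentiation of the primitive at interior points. -/
theorem ae_eq_zero_of_integral_zero {G : ℝ → ℂ} (hG : IntegrableOn G (Icc 0 1))
    (h : ∀ x ∈ Icc (0 : ℝ) 1, ∫ y in (0 : ℝ)..x, G y = 0) :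
    G =ᵐ[volume.restrict (Icc (0 : ℝ) 1)] 0 := by
  have h1 := (hG.intervalIntegrable_unit zero_mem_unit one_mem_unit).ae_hasDerivAt_integral
  have h0 : ∀ᵐ x : ℝ, x ≠ 0 := by simp [ae_iff, measure_singleton]
  have h01 : ∀ᵐ x : ℝ, x ≠ 1 := by simp [ae_iff, measure_singleton]
  rw [EventuallyEq, ae_restrict_iff' measurableSet_Icc]
  filter_upwards [h1, h0, h01] with x hx hx0 hx1 hxI
  have h2 := hx (by rwa [uIcc_of_le zero_le_one]) 0 left_mem_uIcc
  have hnhds : Icc (0 : ℝ) 1 ∈ 𝓝 x :=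
    Icc_mem_nhds (lt_of_le_of_ne hxI.1 hx0.symm) (lt_of_le_of_ne hxI.2 hx1)
  refine h2.unique ((hasDerivAt_const x (0 : ℂ)).congr_of_eventuallyEq ?_)
  filter_upwards [hnhds] with y hy using h y hy

attribute [local fun_prop] Complex.continuous_ofReal

/-! ### The inverse of the Dirichlet operator `D D*`, `D = e ∂ₓ e⁻¹` -/

namespace GroundStateData

variable {V : ℝ → ℝ} (G : GroundStateData V)

theorem cont_e_ofReal : Continuous fun x => (G.e x : ℂ) :=
  Complex.continuous_ofReal.comp G.cont_e

theorem e_ofReal_ne_zero (x : ℝ) : (G.e x : ℂ) ≠ 0 :=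
  Complex.ofReal_ne_zero.2 (G.e_pos x).ne'

theorem cont_e_inv_ofReal : Continuous fun x => (G.e x : ℂ)⁻¹ :=
  G.cont_e_ofReal.inv₀ G.e_ofReal_ne_zero

/-- `T f = ∫₀ˣ f / e`. -/
noncomputable def T (f : L2C) (x : ℝ) : ℂ := ∫ y in (0 : ℝ)..x, (G.e y : ℂ)⁻¹ * f y

/-- The mean of `T f` for the probability measure `e² dx`. -/
noncomputable def meanT (f : L2C) : ℂ := ∫ y in (0 : ℝ)..1, (G.e y : ℂ) ^ 2 * G.T f y

/-- `B f = e (T f - ∫ e² T f)` solves `D (B f) = f`, and `B f` is orthogonal to `e`. -/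
noncomputable def B (f : L2C) (x : ℝ) : ℂ := G.e x * (G.T f x - G.meanT f)

/-- The primitive of `e B f`. -/
noncomputable def Q (f : L2C) (x : ℝ) : ℂ := ∫ y in (0 : ℝ)..x, (G.e y : ℂ) * G.B f y

/-- `K f` solves `D D* (K f) = f` with Dirichlet boundary conditions. -/
noncomputable def K (f : L2C) (x : ℝ) : ℂ := -(G.e x : ℂ)⁻¹ * G.Q f x

theorem isBoundedFamily_T : IsBoundedFamily G.T :=
  IsBoundedFamily.primitive G.cont_e_inv_ofReal.continuousOn

theorem isBoundedFamily_T_sub_mean : IsBoundedFamily fun f x => G.T f x - G.meanT f :=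
  G.isBoundedFamily_T.sub
    ((G.isBoundedFamily_T.mul_left (G.cont_e_ofReal.pow 2).continuousOn).integral.eval_one)

theorem isBoundedFamily_B : IsBoundedFamily G.B :=
  G.isBoundedFamily_T_sub_mean.mul_left G.cont_e_ofReal.continuousOn

theorem isBoundedFamily_Q : IsBoundedFamily G.Q :=
  (G.isBoundedFamily_B.mul_left G.cont_e_ofReal.continuousOn).integral

theorem isBoundedFamily_K : IsBoundedFamily G.K :=
  G.isBoundedFamily_Q.mul_left G.cont_e_inv_ofReal.neg.continuousOn

theorem Q_zero (f : L2C) : G.Q f 0 = 0 := intervalIntegral.integral_same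

/-- As `e²` has integral one, subtracting the mean makes `B f` orthogonal to `e`. This is the
Dirichlet condition of `K f` at `1`. -/
theorem Q_one (f : L2C) : G.Q f 1 = 0 := by
  have hT := G.isBoundedFamily_T.cont f
  have he := G.cont_e
  have e1 : G.Q f 1 = G.meanT f - G.meanT f * ∫ y in (0 : ℝ)..1, (G.e y : ℂ) ^ 2 := by
    rw [Q, meanT, ← intervalIntegral.integral_const_mul, ← intervalIntegral.integral_sub]
    · refine intervalIntegral.integral_congr fun y _ => ?_
      simp only [B, meanT]
      ring
    all_goals exact ContinuousOn.intervalIntegrable_zero (by fun_prop) one_mem_unit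
  have e2 : ∫ y in (0 : ℝ)..1, (G.e y : ℂ) ^ 2 = 1 := by
    have := G.norm_e
    rw [← Complex.ofReal_inj, ← intervalIntegral.integral_ofReal] at this
    simpa using this
  rw [e1, e2, mul_one, sub_self]

theorem hasDeriv_Q (f : L2C) {x : ℝ} (hx : x ∈ Icc (0 : ℝ) 1) :
    HasDerivWithinAt (G.Q f) (G.e x * G.B f x) (Icc 0 1) x :=
  hasDerivWithinAt_integral_zero
    ((G.isBoundedFamily_B.mul_left G.cont_e_ofReal.continuousOn).cont f) hx

/-- Formally `⟨K f, D D* K f⟩ = ‖D* K f‖²` with `D* K f = B f`. One integration by parts suffices,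
with boundary terms removed by `Q_zero` and `Q_one`. -/
theorem integral_star_K_mul (f : L2C) :
    ∫ x in (0 : ℝ)..1, star (G.K f x) * f x = ((∫ x in (0 : ℝ)..1, ‖G.B f x‖ ^ 2 : ℝ) : ℂ) := by
  have hB := G.isBoundedFamily_B.cont f
  have he := G.cont_e
  have hstar : ∀ x ∈ Icc (0 : ℝ) 1,
      HasDerivWithinAt (fun x => star (G.Q f x)) (star (G.e x * G.B f x)) (Icc 0 1) x :=
    fun x hx => (G.hasDeriv_Q f hx).star
  have hc : ContinuousOn (fun x => star (G.e x * G.B f x)) (Icc 0 1) := by fun_prop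
  have hibp := integral_mul_eq_neg_integral_deriv_mul_primitive hstar hc
    (by simp [G.Q_one f]) (integrableOn_mul_Lp G.cont_e_inv_ofReal.continuousOn f)
  have e1 : ∫ x in (0 : ℝ)..1, star (G.K f x) * f x =
      -∫ x in (0 : ℝ)..1, star (G.Q f x) * ((G.e x : ℂ)⁻¹ * f x) := by
    rw [← intervalIntegral.integral_neg]
    refine intervalIntegral.integral_congr fun y _ => ?_
    simp only [K, star_mul', star_neg, star_inv₀, Complex.star_def, Complex.conj_ofReal]
    ring
  have e2 : ∫ x in (0 : ℝ)..1, star (G.e x * G.B f x) * G.T f x =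
      ∫ x in (0 : ℝ)..1, star (G.B f x) * G.B f x := by
    -- Orthogonality of `B f` and `e` lets `T f` be replaced by `T f - meanT f`, which is `B f / e`.
    have e3 : ∫ x in (0 : ℝ)..1, star (G.e x * G.B f x) * G.meanT f = 0 := by
      have h := integral_zero_eq_sub hstar hc one_mem_unit
      rw [intervalIntegral.integral_mul_const, h, G.Q_one, G.Q_zero]
      simp
    have hT := G.isBoundedFamily_T.cont f
    rw [← sub_zero (∫ x in (0 : ℝ)..1, star (G.e x * G.B f x) * G.T f x), ← e3,
      ← intervalIntegral.integral_sub]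
    · refine intervalIntegral.integral_congr fun y _ => ?_
      have : G.B f y = G.e y * (G.T f y - G.meanT f) := rfl
      simp only [star_mul', Complex.star_def, Complex.conj_ofReal]
      rw [this]
      ring
    all_goals exact ContinuousOn.intervalIntegrable_zero (by fun_prop) one_mem_unit
  rw [e1, hibp, neg_neg]
  refine e2.trans ?_
  rw [← intervalIntegral.integral_ofReal]
  refine intervalIntegral.integral_congr fun y _ => ?_
  simp only [Complex.star_def, ← Complex.normSq_eq_conj_mul_self, Complex.normSq_eq_norm_sq]

theorem inner_K {Kop : L2C →L[ℂ] L2C}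
    (hK : ∀ f, Kop f =ᵐ[volume.restrict (Icc (0 : ℝ) 1)] G.K f) (f : L2C) :
    inner ℂ (Kop f) f = ((∫ x in (0 : ℝ)..1, ‖G.B f x‖ ^ 2 : ℝ) : ℂ) := by
  rw [← G.integral_star_K_mul, L2.inner_def, intervalIntegral.integral_of_le zero_le_one,
    ← integral_Icc_eq_integral_Ioc]
  refine integral_congr_ae ?_
  filter_upwards [hK f] with x hx
  rw [hx, RCLike.inner_apply', Complex.star_def]

/-- Over `ℂ`, a real nonnegative quadratic form already forces self-adjointness; this is a gain from
complexifying `L²`. -/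
theorem nonneg_K {Kop : L2C →L[ℂ] L2C}
    (hK : ∀ f, Kop f =ᵐ[volume.restrict (Icc (0 : ℝ) 1)] G.K f) : 0 ≤ Kop := by
  rw [ContinuousLinearMap.nonneg_iff_isPositive, ContinuousLinearMap.isPositive_iff_complex]
  intro f
  rw [G.inner_K hK f]
  exact ⟨rfl, intervalIntegral.integral_nonneg zero_le_one fun x _ => sq_nonneg _⟩

/-- If `K f = 0`, the quadratic form gives `B f = 0`, so `T f` is constant. It vanishes at `0`,
hence `f/e` has zero primitive. -/
theorem injective_K {Kop : L2C →L[ℂ] L2C}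
    (hK : ∀ f, Kop f =ᵐ[volume.restrict (Icc (0 : ℝ) 1)] G.K f) (f : L2C) (hf : Kop f = 0) :
    f = 0 := by
  have h1 := G.inner_K hK f
  rw [hf, inner_zero_left, eq_comm, Complex.ofReal_eq_zero] at h1
  have hB := G.isBoundedFamily_B.cont f
  have hB0 : ∀ x ∈ Icc (0 : ℝ) 1, G.B f x = 0 := by
    by_contra! hne
    obtain ⟨x, hx, hx0⟩ := hne
    have := intervalIntegral.integral_pos zero_lt_one (hB.norm.pow 2)
      (fun x _ => sq_nonneg _) ⟨x, hx, pow_pos (norm_pos_iff.2 hx0) 2⟩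
    exact this.ne' h1
  have hT : ∀ x ∈ Icc (0 : ℝ) 1, G.T f x = G.meanT f := fun x hx =>
    sub_eq_zero.1 ((mul_eq_zero.1 (hB0 x hx)).resolve_left (G.e_ofReal_ne_zero x))
  have hT0 : G.meanT f = 0 := by
    rw [← hT 0 zero_mem_unit]; exact intervalIntegral.integral_same
  have h2 := ae_eq_zero_of_integral_zero
    (integrableOn_mul_Lp G.cont_e_inv_ofReal.continuousOn f)
    fun x hx => (hT x hx).trans hT0
  rw [Lp.eq_zero_iff_ae_eq_zero]
  filter_upwards [h2] with x hx
  exact (mul_eq_zero.1 hx).resolve_left (inv_ne_zero (G.e_ofReal_ne_zero x))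

/-- Orbits of the heat semigroup generated by `-D D*`. -/
theorem exists_heat_orbit (w : L2C) :
    ∃ h : ℕ → ℝ → L2C,
      (∀ n, ∀ t > 0, h n t =ᵐ[volume.restrict (Icc (0 : ℝ) 1)] G.K (h (n + 1) t)) ∧
      (∀ n, ∀ t > 0, HasDerivAt (h n) (-h (n + 1) t) t) ∧
      Tendsto (h 0) (𝓝[>] 0) (𝓝 w) ∧ Tendsto (h 0) atTop (𝓝 0) := by
  obtain ⟨Kop, hK⟩ := G.isBoundedFamily_K.exists_toLp
  obtain ⟨h, h1, h2, h3, h4⟩ := exists_smoothing_orbit (G.nonneg_K hK) (G.injective_K hK) w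
  refine ⟨h, fun n t ht => ?_, h2, h3, h4⟩
  rw [← h1 n t ht]
  exact hK _

end GroundStateData

/-! ### From the linear equation to the Burgers equation -/

theorem hasDerivAt_max_zero_pow (n : ℕ) (y : ℝ) :
    HasDerivAt (fun y : ℝ => max y 0 ^ (n + 2)) ((n + 2) * max y 0 ^ (n + 1)) y := by
  rcases lt_trichotomy y 0 with hy | rfl | hy
  · rw [max_eq_right hy.le, zero_pow (by omega), mul_zero]
    refine (hasDerivAt_const y (0 : ℝ)).congr_of_eventuallyEq ?_
    filter_upwards [Iio_mem_nhds hy] with z hz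
    rw [max_eq_right (le_of_lt hz), zero_pow (by omega)]
  · rw [max_self, zero_pow (by omega), mul_zero, hasDerivAt_iff_isLittleO_nhds_zero]
    simp only [zero_add, max_self, smul_zero, sub_zero]
    rw [zero_pow (by omega)]
    simp only [sub_zero]
    refine Asymptotics.IsBigO.trans_isLittleO (g := fun h : ℝ => h ^ (n + 2)) ?_
      (by simpa using Asymptotics.isLittleO_pow_id (𝕜 := ℝ) (n := n + 2) (by omega))
    refine Asymptotics.IsBigO.of_bound 1 (Eventually.of_forall fun h => ?_)
    rw [one_mul, norm_pow, norm_pow]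
    gcongr
    rw [Real.norm_of_nonneg (le_max_right _ _)]
    exact max_le (le_abs_self h) (abs_nonneg h)
  · rw [max_eq_left hy.le]
    have h := hasDerivAt_pow (n + 2) y
    push_cast at h
    refine h.congr_of_eventuallyEq ?_
    filter_upwards [Ioi_mem_nhds hy] with z hz
    rw [max_eq_left (le_of_lt hz)]

section

variable {V : ℝ → ℝ}

/-- `φ` solves `e² ∂ₜφ = ∂ₓ(e² ∂ₓφ)` with Neumann boundary conditions for positive times;
`w = e ∂ₓφ`, `b = -e ∂ₜφ` and `H = -∂ₜw`. -/
structure IsHeatSolution (G : GroundStateData V) (φ w b H : ℝ → ℝ → ℝ) : Prop where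
  cont_φ : ContinuousOn (fun p : ℝ × ℝ => φ p.1 p.2) (Ioi 0 ×ˢ Icc 0 1)
  cont_w : ContinuousOn (fun p : ℝ × ℝ => w p.1 p.2) (Ioi 0 ×ˢ Icc 0 1)
  cont_b : ContinuousOn (fun p : ℝ × ℝ => b p.1 p.2) (Ioi 0 ×ˢ Icc 0 1)
  cont_H : ContinuousOn (fun p : ℝ × ℝ => H p.1 p.2) (Ioi 0 ×ˢ Icc 0 1)
  φ_t : ∀ t > 0, ∀ x ∈ Icc (0 : ℝ) 1, HasDerivAt (fun τ => φ τ x) (-(b t x / G.e x)) t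
  w_t : ∀ t > 0, ∀ x ∈ Icc (0 : ℝ) 1, HasDerivAt (fun τ => w τ x) (-H t x) t
  φ_x : ∀ t > 0, ∀ x ∈ Icc (0 : ℝ) 1, HasDerivWithinAt (φ t) (w t x / G.e x) (Icc 0 1) x
  w_x : ∀ t > 0, ∀ x ∈ Icc (0 : ℝ) 1,
    HasDerivWithinAt (w t) (-b t x - G.r x * w t x) (Icc 0 1) x
  b_x : ∀ t > 0, ∀ x ∈ Icc (0 : ℝ) 1,
    HasDerivWithinAt (b t) (G.r x * b t x + H t x) (Icc 0 1) x
  w_zero : ∀ t > 0, w t 0 = 0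
  w_one : ∀ t > 0, w t 1 = 0

namespace IsHeatSolution

variable {G : GroundStateData V} {φ w b H : ℝ → ℝ → ℝ}

/-- With `p = (k - φ)₊`, the left side is the time derivative of `∫ e² p³`. Since `e b = -(e w)'`
and `w` vanishes at the ends, integration by parts against `3 p²` makes it nonpositive. The cube
keeps every derivative involved classical. -/
theorem energy_identity {e r φ w b p : ℝ → ℝ} {k : ℝ} (he0 : ∀ x, e x ≠ 0) (hec : Continuous e)
    (hbc : ContinuousOn b (Icc 0 1)) (hp : ∀ x, p x = max (k - φ x) 0)
    (he : ∀ x ∈ Icc (0 : ℝ) 1, HasDerivWithinAt e (r x * e x) (Icc 0 1) x)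
    (hφ : ∀ x ∈ Icc (0 : ℝ) 1, HasDerivWithinAt φ (w x / e x) (Icc 0 1) x)
    (hw : ∀ x ∈ Icc (0 : ℝ) 1, HasDerivWithinAt w (-b x - r x * w x) (Icc 0 1) x)
    (hw0 : w 0 = 0) (hw1 : w 1 = 0) :
    ∫ x in (0 : ℝ)..1, e x ^ 2 * (3 * p x ^ 2 * (b x / e x)) =
      -∫ x in (0 : ℝ)..1, 6 * p x * w x ^ 2 := by
  have cφ : ContinuousOn φ (Icc 0 1) := fun x hx => (hφ x hx).continuousWithinAt
  have cw : ContinuousOn w (Icc 0 1) := fun x hx => (hw x hx).continuousWithinAt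
  have cp : ContinuousOn p (Icc 0 1) := by
    simp only [funext hp]
    exact (continuousOn_const.sub cφ).sup continuousOn_const
  have d1 : ∀ x ∈ Icc (0 : ℝ) 1,
      HasDerivWithinAt (fun x => e x * w x) (-(e x * b x)) (Icc 0 1) x := fun x hx => by
    convert! (he x hx).mul (hw x hx) using 1
    ring
  have d2 : ∀ x ∈ Icc (0 : ℝ) 1,
      HasDerivWithinAt (fun x => 3 * p x ^ 2) (-(6 * p x * (w x / e x))) (Icc 0 1) x :=
    fun x hx => by
      have h1 := ((hasDerivAt_max_zero_pow 0 (k - φ x)).comp_hasDerivWithinAt x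
        ((hφ x hx).const_sub k)).const_mul 3
      simp only [funext hp]
      convert! h1 using 1
      push_cast
      ring
  have key := integral_mul_deriv_add_deriv_mul_zero d2 d1
    ((((continuousOn_const.mul cp).mul (cw.div hec.continuousOn fun x _ => he0 x))).neg)
    (hec.continuousOn.mul hbc).neg
  simp only [hw0, hw1, mul_zero, sub_self, zero_sub] at key
  have e1 : ∫ x in (0 : ℝ)..1, e x ^ 2 * (3 * p x ^ 2 * (b x / e x)) =
      -∫ x in (0 : ℝ)..1, 3 * p x ^ 2 * -(e x * b x) := by
    rw [← intervalIntegral.integral_neg]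
    refine intervalIntegral.integral_congr fun x _ => ?_
    have := he0 x
    field_simp
  rw [e1, key, neg_neg, ← intervalIntegral.integral_neg]
  refine intervalIntegral.integral_congr fun x _ => ?_
  have := he0 x
  field_simp

/-- The minimum principle. -/
theorem le_of_eventually_le (h : IsHeatSolution G φ w b H) {m : ℝ}
    (hm : ∀ ε > 0, ∀ᶠ t in 𝓝[>] 0, ∀ x ∈ Icc (0 : ℝ) 1, m - ε ≤ φ t x) {t x : ℝ} (ht : 0 < t)
    (hx : x ∈ Icc (0 : ℝ) 1) : m ≤ φ t x := by
  refine le_of_forall_pos_sub_le fun ε hε => ?_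
  set k := m - ε with hk
  set p : ℝ → ℝ → ℝ := fun t x => max (k - φ t x) 0 with hp
  have hpc : ContinuousOn (fun q : ℝ × ℝ => p q.1 q.2) (Ioi 0 ×ˢ Icc 0 1) :=
    (continuousOn_const.sub h.cont_φ).sup continuousOn_const
  have hec : ContinuousOn (fun q : ℝ × ℝ => G.e q.2) (Ioi (0 : ℝ) ×ˢ Icc (0 : ℝ) 1) :=
    (G.cont_e.comp continuous_snd).continuousOn
  have hder : ∀ t > 0, HasDerivAt (fun τ => ∫ x in (0 : ℝ)..1, G.e x ^ 2 * p τ x ^ 3)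
      (∫ x in (0 : ℝ)..1, G.e x ^ 2 * (3 * p t x ^ 2 * (b t x / G.e x))) t := by
    intro t ht
    refine hasDerivAt_integral_unit (F := fun t x => G.e x ^ 2 * p t x ^ 3)
      (F' := fun t x => G.e x ^ 2 * (3 * p t x ^ 2 * (b t x / G.e x)))
      ((hec.pow 2).mul (hpc.pow 3)) ((hec.pow 2).mul ((continuousOn_const.mul (hpc.pow 2)).mul
        (h.cont_b.div hec fun q _ => (G.e_pos q.2).ne'))) (fun t ht x hx => ?_) ht
    have h1 := ((hasDerivAt_max_zero_pow 1 (k - φ t x)).comp t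
      ((h.φ_t t ht x hx).const_sub k)).const_mul (G.e x ^ 2)
    convert! h1 using 1
    simp only [hp]
    push_cast
    ring
  have hnonneg : ∀ t, 0 ≤ ∫ x in (0 : ℝ)..1, G.e x ^ 2 * p t x ^ 3 := fun t =>
    intervalIntegral.integral_nonneg zero_le_one fun x _ =>
      mul_nonneg (sq_nonneg _) (pow_nonneg (le_max_right _ _) 3)
  have hanti : AntitoneOn (fun τ => ∫ x in (0 : ℝ)..1, G.e x ^ 2 * p τ x ^ 3) (Ioi 0) := by
    refine antitoneOn_of_hasDerivWithinAt_nonpos (convex_Ioi 0)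
      (fun τ hτ => (hder τ hτ).continuousAt.continuousWithinAt)
      (f' := fun t => ∫ x in (0 : ℝ)..1, G.e x ^ 2 * (3 * p t x ^ 2 * (b t x / G.e x))) ?_ ?_
    · exact fun τ hτ => (hder τ (interior_subset hτ)).hasDerivWithinAt
    · intro τ hτ
      have hτ0 : 0 < τ := interior_subset hτ
      rw [energy_identity (k := k) (φ := φ τ) (w := w τ) (r := G.r) (fun x => (G.e_pos x).ne')
        G.cont_e (h.cont_b.slice (s := Ioi 0) hτ0) (fun x => rfl) G.hasDeriv_e (h.φ_x τ hτ0)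
        (h.w_x τ hτ0) (h.w_zero τ hτ0) (h.w_one τ hτ0)]
      refine neg_nonpos.2 (intervalIntegral.integral_nonneg zero_le_one fun x _ => ?_)
      exact mul_nonneg (mul_nonneg (by norm_num) (le_max_right _ _)) (sq_nonneg _)
  -- At some time before `t` the solution is at least `k` everywhere, so the nonincreasing integral
  -- of `e² p³` is zero there and afterwards.
  obtain ⟨s, hs, hst, hs0⟩ :=
    ((hm ε hε).and ((Ioo_mem_nhdsGT ht))).exists
  have hzero : ∫ x in (0 : ℝ)..1, G.e x ^ 2 * p s x ^ 3 = 0 := by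
    rw [intervalIntegral.integral_congr (g := fun _ => (0 : ℝ))]
    · simp
    · intro y hy
      rw [uIcc_of_le zero_le_one] at hy
      have : p s y = 0 := max_eq_right (by linarith [hs y hy])
      simp [this]
  have hle : ∫ x in (0 : ℝ)..1, G.e x ^ 2 * p t x ^ 3 ≤ 0 :=
    (hanti hst ht hs0.le).trans hzero.le
  by_contra! hlt
  have hpos : 0 < p t x := lt_max_of_lt_left (by linarith)
  have := intervalIntegral.integral_pos zero_lt_one
    (f := fun x => G.e x ^ 2 * p t x ^ 3)
    ((G.cont_e.continuousOn.pow 2).mul ((hpc.slice (s := Ioi 0) ht).pow 3))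
    (fun x _ => mul_nonneg (sq_nonneg _) (pow_nonneg (le_max_right _ _) 3))
    ⟨x, hx, mul_pos (pow_pos (G.e_pos x) 2) (pow_pos hpos 3)⟩
  linarith

/-- The Cole–Hopf transform. -/
theorem isClassicalBurgersSolution (hV : ContDiffOn ℝ 1 V (Icc 0 1))
    (h : IsHeatSolution G φ w b H) (hφ : ∀ t > 0, ∀ x ∈ Icc (0 : ℝ) 1, 0 < φ t x) :
    IsClassicalBurgersSolution V fun t x => -2 * (G.r x + w t x / (G.e x * φ t x)) := by
  have hne : ∀ t > 0, ∀ x ∈ Icc (0 : ℝ) 1, G.e x * φ t x ≠ 0 := fun t ht x hx =>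
    (mul_pos (G.e_pos x) (hφ t ht x hx)).ne'
  have hec : ContinuousOn (fun q : ℝ × ℝ => G.e q.2) (Ioi (0 : ℝ) ×ˢ Icc (0 : ℝ) 1) :=
    (G.cont_e.comp continuous_snd).continuousOn
  have lift : ∀ {f : ℝ → ℝ}, ContinuousOn f (Icc 0 1) →
      ContinuousOn (fun q : ℝ × ℝ => f q.2) (Ioi (0 : ℝ) ×ˢ Icc (0 : ℝ) 1) := fun hf =>
    hf.comp continuous_snd.continuousOn fun q hq => hq.2
  have hrc := lift G.cont_r
  have hVc := lift hV.continuousOn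
  have hVxc := lift (continuousOn_derivWithin_unit hV)
  have hD : ContinuousOn (fun q : ℝ × ℝ => G.e q.2 * φ q.1 q.2) (Ioi 0 ×ˢ Icc 0 1) :=
    hec.mul h.cont_φ
  have hne' : ∀ q ∈ Ioi (0 : ℝ) ×ˢ Icc (0 : ℝ) 1, G.e q.2 * φ q.1 q.2 ≠ 0 :=
    fun q hq => hne q.1 hq.1 q.2 hq.2
  -- Here `z = ∂ₓφ/φ`, `β = -∂ₜφ/φ` and `γ = -∂ₜw/(e φ)`. Their derivatives needed below are
  -- polynomial in `z`, `β`, `γ` and `r`.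
  set z : ℝ → ℝ → ℝ := fun t x => w t x / (G.e x * φ t x) with hz
  set β : ℝ → ℝ → ℝ := fun t x => b t x / (G.e x * φ t x) with hβ
  set γ : ℝ → ℝ → ℝ := fun t x => H t x / (G.e x * φ t x) with hγ
  have cz : ContinuousOn (fun q : ℝ × ℝ => z q.1 q.2) (Ioi 0 ×ˢ Icc 0 1) := h.cont_w.div hD hne'
  have cβ : ContinuousOn (fun q : ℝ × ℝ => β q.1 q.2) (Ioi 0 ×ˢ Icc 0 1) := h.cont_b.div hD hne'
  have cγ : ContinuousOn (fun q : ℝ × ℝ => γ q.1 q.2) (Ioi 0 ×ˢ Icc 0 1) := h.cont_H.div hD hne'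
  have hz_t : ∀ t > 0, ∀ x ∈ Icc (0 : ℝ) 1,
      HasDerivAt (fun τ => z τ x) (-γ t x + z t x * β t x) t := fun t ht x hx => by
    have he := (G.e_pos x).ne'
    have hp := (hφ t ht x hx).ne'
    convert! (h.w_t t ht x hx).div ((h.φ_t t ht x hx).const_mul (G.e x)) (hne t ht x hx) using 1
    simp only [hz, hβ, hγ]
    field_simp
    ring
  have hD_x : ∀ t > 0, ∀ x ∈ Icc (0 : ℝ) 1, HasDerivWithinAt (fun x => G.e x * φ t x)
      (G.r x * (G.e x * φ t x) + w t x) (Icc 0 1) x := fun t ht x hx => by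
    have he := (G.e_pos x).ne'
    convert! (G.hasDeriv_e x hx).mul (h.φ_x t ht x hx) using 1
    field_simp
  have hz_x : ∀ t > 0, ∀ x ∈ Icc (0 : ℝ) 1, HasDerivWithinAt (z t)
      (-β t x - 2 * G.r x * z t x - z t x ^ 2) (Icc 0 1) x := fun t ht x hx => by
    have he := (G.e_pos x).ne'
    have hp := (hφ t ht x hx).ne'
    convert! (h.w_x t ht x hx).div (hD_x t ht x hx) (hne t ht x hx) using 1
    simp only [hz, hβ]
    field_simp
    ring
  have hβ_x : ∀ t > 0, ∀ x ∈ Icc (0 : ℝ) 1, HasDerivWithinAt (β t)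
      (γ t x - β t x * z t x) (Icc 0 1) x := fun t ht x hx => by
    have he := (G.e_pos x).ne'
    have hp := (hφ t ht x hx).ne'
    convert! (h.b_x t ht x hx).div (hD_x t ht x hx) (hne t ht x hx) using 1
    simp only [hz, hβ, hγ]
    field_simp
    ring
  have hz0 : ∀ t > 0, z t 0 = 0 ∧ z t 1 = 0 := fun t ht => by
    simp [hz, h.w_zero t ht, h.w_one t ht]
  suffices hs : IsClassicalBurgersSolution V fun t x => -2 * (G.r x + z t x) from hs
  clear_value z β γ
  refine ⟨fun t x => 2 * (γ t x - z t x * β t x),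
    fun t x => -2 * (V x - G.lam - β t x - (G.r x + z t x) ^ 2),
    fun t x => -2 * derivWithin V (Icc 0 1) x + 2 * (γ t x - β t x * z t x) +
      4 * (G.r x + z t x) * (V x - G.lam - β t x - (G.r x + z t x) ^ 2),
    continuousOn_const.mul (hrc.add cz), continuousOn_const.mul (cγ.sub (cz.mul cβ)),
    continuousOn_const.mul (((hVc.sub continuousOn_const).sub cβ).sub ((hrc.add cz).pow 2)),
    ((continuousOn_const.mul hVxc).add (continuousOn_const.mul (cγ.sub (cβ.mul cz)))).add
      ((continuousOn_const.mul (hrc.add cz)).mul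
        (((hVc.sub continuousOn_const).sub cβ).sub ((hrc.add cz).pow 2))), ?_, ?_⟩
  · intro t ht
    simp [G.r_zero, G.r_one, (hz0 t ht).1, (hz0 t ht).2]
  · intro t ht x hx
    -- The sum `r + z` is the logarithmic derivative of `e φ` and again satisfies a Riccati
    -- equation. Differentiating it once more, where `V` must be `C¹`, reduces Burgers to algebra.
    have hu_x : HasDerivWithinAt (fun x => G.r x + z t x)
        (V x - G.lam - β t x - (G.r x + z t x) ^ 2) (Icc 0 1) x := by
      convert! (G.hasDeriv_r x hx).add (hz_x t ht x hx) using 1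
      ring
    have hVd : HasDerivWithinAt V (derivWithin V (Icc 0 1) x) (Icc 0 1) x :=
      (hV.differentiableOn one_ne_zero x hx).hasDerivWithinAt
    refine ⟨?_, hu_x.const_mul (-2), ?_, by ring⟩
    · convert! ((hz_t t ht x hx).const_add (G.r x)).const_mul (-2) using 1
      simp only
      ring
    · convert! (((hVd.sub_const G.lam).sub (hβ_x t ht x hx)).sub (hu_x.pow 2)).const_mul (-2)
        using 1
      push_cast
      ring

end IsHeatSolution

end

/-! ### Existence of solutions -/

theorem HasDerivWithinAt.complex_re {f : ℝ → ℂ} {f' : ℂ} {s : Set ℝ} {x : ℝ}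
    (h : HasDerivWithinAt f f' s x) : HasDerivWithinAt (fun y => (f y).re) f'.re s x :=
  Complex.reCLM.hasFDerivAt.comp_hasDerivWithinAt x h

theorem HasDerivAt.complex_re {f : ℝ → ℂ} {f' : ℂ} {x : ℝ}
    (h : HasDerivAt f f' x) : HasDerivAt (fun y => (f y).re) f'.re x :=
  Complex.reCLM.hasFDerivAt.comp_hasDerivAt x h

namespace GroundStateData

variable {V : ℝ → ℝ} (G : GroundStateData V)

theorem hasDeriv_e_ofReal {x : ℝ} (hx : x ∈ Icc (0 : ℝ) 1) :
    HasDerivWithinAt (fun x => (G.e x : ℂ)) (G.r x * G.e x) (Icc 0 1) x := by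
  have := (G.hasDeriv_e x hx).ofReal_comp
  simpa using this

/-- An `L²` class has no pointwise values; the continuous representative `K g` makes the primitive
differentiable at every point. -/
theorem hasDeriv_T {f g : L2C} (hfg : f =ᵐ[volume.restrict (Icc (0 : ℝ) 1)] G.K g) {x : ℝ}
    (hx : x ∈ Icc (0 : ℝ) 1) :
    HasDerivWithinAt (G.T f) ((G.e x : ℂ)⁻¹ * G.K g x) (Icc 0 1) x := by
  have hc := (G.isBoundedFamily_K.mul_left G.cont_e_inv_ofReal.continuousOn).cont g
  have hT : ∀ x ∈ Icc (0 : ℝ) 1, G.T f x = ∫ y in (0 : ℝ)..x, (G.e y : ℂ)⁻¹ * G.K g y :=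
    fun x hx => intervalIntegral.integral_congr_ae (by
      filter_upwards [ae_eq_of_Icc hx hfg] with y hy hy'
      rw [hy hy'])
  exact (hasDerivWithinAt_integral_zero hc hx).congr hT (hT x hx)

theorem hasDeriv_B {f g : L2C} (hfg : f =ᵐ[volume.restrict (Icc (0 : ℝ) 1)] G.K g) {x : ℝ}
    (hx : x ∈ Icc (0 : ℝ) 1) :
    HasDerivWithinAt (G.B f) (G.r x * G.B f x + G.K g x) (Icc 0 1) x := by
  have he := G.e_ofReal_ne_zero x
  convert! (G.hasDeriv_e_ofReal hx).mul ((G.hasDeriv_T hfg hx).sub_const (G.meanT f)) using 1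
  rw [B]
  field_simp

theorem hasDeriv_K (f : L2C) {x : ℝ} (hx : x ∈ Icc (0 : ℝ) 1) :
    HasDerivWithinAt (G.K f) (-G.B f x - G.r x * G.K f x) (Icc 0 1) x := by
  have he := G.e_ofReal_ne_zero x
  convert! ((G.hasDeriv_e_ofReal hx).inv he).neg.mul (G.hasDeriv_Q f hx) using 1
  simp only [K, Pi.neg_apply, Pi.inv_apply]
  field_simp
  ring

/-- Since `h n` is `K (h (n + 1))` almost everywhere, `w` and `H` are continuous representatives of
`Re (h 0)` and `Re (h 1)`. Real parts preserve the equations because `e` and `r` are real. The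
constant `c` is free: it is the `e²`-mean of `φ`. -/
theorem isHeatSolution_of_orbit (c : ℝ) {h : ℕ → ℝ → L2C}
    (h1 : ∀ n, ∀ t > 0, h n t =ᵐ[volume.restrict (Icc (0 : ℝ) 1)] G.K (h (n + 1) t))
    (h2 : ∀ n, ∀ t > 0, HasDerivAt (h n) (-h (n + 1) t) t) :
    IsHeatSolution G (fun t x => c + (G.T (h 0 t) x - G.meanT (h 0 t)).re)
      (fun t x => (G.K (h 1 t) x).re) (fun t x => (G.B (h 1 t) x).re)
      (fun t x => (G.K (h 2 t) x).re) := by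
  have hc : ∀ n, ContinuousOn (h n) (Ioi 0) := fun n t ht =>
    (h2 n t ht).continuousAt.continuousWithinAt
  have hre : ∀ {F : ℝ × ℝ → ℂ}, ContinuousOn F (Ioi 0 ×ˢ Icc 0 1) →
      ContinuousOn (fun p => (F p).re) (Ioi 0 ×ˢ Icc 0 1) := fun hF =>
    Complex.continuous_re.comp_continuousOn hF
  refine ⟨continuousOn_const.add (hre (G.isBoundedFamily_T_sub_mean.continuousOn_uncurry (hc 0))),
    hre (G.isBoundedFamily_K.continuousOn_uncurry (hc 1)),
    hre (G.isBoundedFamily_B.continuousOn_uncurry (hc 1)),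
    hre (G.isBoundedFamily_K.continuousOn_uncurry (hc 2)),
    fun t ht x hx => ?_, fun t ht x hx => ?_, fun t ht x hx => ?_, fun t ht x hx => ?_,
    fun t ht x hx => ?_, fun t _ => ?_, fun t _ => ?_⟩
  · have := ((G.isBoundedFamily_T_sub_mean.hasDerivAt hx (h2 0 t ht)).complex_re).const_add c
    convert! this using 1
    have e := G.isBoundedFamily_T_sub_mean.neg hx (h 1 t)
    have he := (G.e_pos x).ne'
    rw [zero_add, e, Complex.neg_re, B, Complex.re_ofReal_mul]
    field_simp
  · have := (G.isBoundedFamily_K.hasDerivAt hx (h2 1 t ht)).complex_re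
    rwa [G.isBoundedFamily_K.neg hx, Complex.neg_re] at this
  · have := (((G.hasDeriv_T (h1 0 t ht) hx).sub_const (G.meanT (h 0 t))).complex_re).const_add c
    convert! this using 1
    rw [← Complex.ofReal_inv, Complex.re_ofReal_mul]
    ring
  · have := (G.hasDeriv_K (h 1 t) hx).complex_re
    rwa [Complex.sub_re, Complex.neg_re, Complex.re_ofReal_mul] at this
  · have := (G.hasDeriv_B (h1 1 t ht) hx).complex_re
    rwa [Complex.add_re, Complex.re_ofReal_mul] at this
  · simp [K, G.Q_zero]
  · simp [K, G.Q_one]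

/-! ### The Cole–Hopf map on `L²` -/

/-- The potential `φ = c + Re (T h - ∫ e² T h)` with `e ∂ₓφ = Re h`. -/
noncomputable def potential (c : ℝ) (h : L2C) (x : ℝ) : ℝ := c + (G.T h x - G.meanT h).re

/-- The Cole–Hopf map `h ↦ -2 (r + Re h / (e φ))`. -/
noncomputable def coleHopf (c : ℝ) (h : L2C) (x : ℝ) : ℝ :=
  -2 * (G.r x + (h x).re / (G.e x * G.potential c h x))

theorem continuousOn_potential (c : ℝ) (h : L2C) : ContinuousOn (G.potential c h) (Icc 0 1) :=
  continuousOn_const.add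
    (Complex.continuous_re.comp_continuousOn (G.isBoundedFamily_T_sub_mean.cont h))

theorem exists_potential_sub_le (c : ℝ) : ∃ D, 0 ≤ D ∧ ∀ h h' : L2C, ∀ x ∈ Icc (0 : ℝ) 1,
    |G.potential c h x - G.potential c h' x| ≤ D * ‖h - h'‖ := by
  obtain ⟨D, hD0, hD⟩ := G.isBoundedFamily_T_sub_mean.bound
  refine ⟨D, hD0, fun h h' x hx => ?_⟩
  have e := G.isBoundedFamily_T_sub_mean.map_sub hx h h'
  rw [potential, potential, add_sub_add_left_eq_sub, ← Complex.sub_re, ← e]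
  exact (Complex.abs_re_le_norm _).trans (hD _ x hx)

theorem potential_zero (c : ℝ) {x : ℝ} (hx : x ∈ Icc (0 : ℝ) 1) : G.potential c 0 x = c := by
  have := G.isBoundedFamily_T_sub_mean.smul 0 0 x hx
  simp only [zero_smul, zero_mul] at this
  rw [potential, this, Complex.zero_re, add_zero]

theorem memLp_coleHopf {c : ℝ} {h : L2C} (hφ : ∀ x ∈ Icc (0 : ℝ) 1, 0 < G.potential c h x) :
    MemLp (G.coleHopf c h) 2 (volume.restrict (Icc (0 : ℝ) 1)) := by
  have hg : ContinuousOn (fun x => (G.e x * G.potential c h x)⁻¹) (Icc 0 1) :=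
    (G.cont_e.continuousOn.mul (G.continuousOn_potential c h)).inv₀
      fun x hx => (mul_pos (G.e_pos x) (hφ x hx)).ne'
  obtain ⟨C, hC⟩ := isCompact_Icc.exists_bound_of_continuousOn hg
  have hre : MemLp (fun x => (h x).re) 2 (volume.restrict (Icc (0 : ℝ) 1)) := (Lp.memLp h).re
  have h1 : MemLp (fun x => (h x).re / (G.e x * G.potential c h x)) 2
      (volume.restrict (Icc (0 : ℝ) 1)) := by
    refine hre.of_le_mul (c := C) ?_ ?_
    · exact hre.aestronglyMeasurable.mul (hg.aestronglyMeasurable measurableSet_Icc)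
    · refine (ae_restrict_iff' measurableSet_Icc).2 (Eventually.of_forall fun x hx => ?_)
      rw [div_eq_mul_inv, norm_mul, mul_comm]
      gcongr
      exact hC x hx
  obtain ⟨C', hC'⟩ := isCompact_Icc.exists_bound_of_continuousOn G.cont_r
  have h2 : MemLp G.r 2 (volume.restrict (Icc (0 : ℝ) 1)) :=
    MemLp.of_bound (G.cont_r.aestronglyMeasurable measurableSet_Icc) C'
      ((ae_restrict_iff' measurableSet_Icc).2 (Eventually.of_forall hC'))
  exact (h2.add h1).const_mul (-2)

/-- The Cole–Hopf map is locally Lipschitz in `L²` where the potential is bounded below. -/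
theorem exists_coleHopf_sub_le (c : ℝ) {m : ℝ} (hm : 0 < m) :
    ∃ A, 0 ≤ A ∧ ∀ (h h' : L2C) (u u' : L2I),
    (∀ x ∈ Icc (0 : ℝ) 1, m ≤ G.potential c h x) → (∀ x ∈ Icc (0 : ℝ) 1, m ≤ G.potential c h' x) →
    u =ᵐ[volume.restrict (Icc (0 : ℝ) 1)] G.coleHopf c h →
    u' =ᵐ[volume.restrict (Icc (0 : ℝ) 1)] G.coleHopf c h' →
    ‖u - u'‖ ≤ A * (1 + ‖h'‖) * ‖h - h'‖ := by
  obtain ⟨D, hD0, hD⟩ := G.exists_potential_sub_le c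
  obtain ⟨E, hE⟩ := isCompact_Icc.exists_bound_of_continuousOn
    (G.cont_e.inv₀ fun x => (G.e_pos x).ne').continuousOn (s := Icc (0 : ℝ) 1)
  have hE0 : 0 ≤ E := (norm_nonneg _).trans (hE 0 zero_mem_unit)
  -- `E` bounds `1/e`, `m` bounds the potentials below, and `D` is the sup-norm Lipschitz constant
  -- of the potential. `a` accounts for the change of numerator, `b` for that of denominator.
  set a := 2 * E / m with ha
  set b := 2 * E * D / m ^ 2 with hb
  have ha0 : 0 ≤ a := by positivity
  have hb0 : 0 ≤ b := by positivity
  refine ⟨max a b, le_max_of_le_left ha0, fun h h' u u' hφ hφ' hu hu' => ?_⟩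
  have hn : ∀ k : L2C, MemLp (fun x => ‖k x‖) 2 (volume.restrict (Icc (0 : ℝ) 1)) :=
    fun k => (Lp.memLp k).norm
  have hnn : ∀ k : L2C, ‖(hn k).toLp‖ = ‖k‖ := fun k => by
    rw [Lp.norm_toLp, eLpNorm_norm, Lp.norm_def]
  have key : ‖u - u'‖ ≤ ‖a • (hn (h - h')).toLp + (b * ‖h - h'‖) • (hn h').toLp‖ := by
    refine Lp.norm_le_norm_of_ae_le ?_
    filter_upwards [hu, hu', Lp.coeFn_sub u u', Lp.coeFn_sub h h', MemLp.coeFn_toLp (hn (h - h')),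
      MemLp.coeFn_toLp (hn h'), Lp.coeFn_add (a • (hn (h - h')).toLp)
        ((b * ‖h - h'‖) • (hn h').toLp), Lp.coeFn_smul a (hn (h - h')).toLp,
      Lp.coeFn_smul (b * ‖h - h'‖) (hn h').toLp, ae_restrict_mem measurableSet_Icc]
      with x e1 e2 e3 e4 e5 e6 e7 e8 e9 hx
    rw [e3, Pi.sub_apply, e1, e2, e7, Pi.add_apply, e8, e9, Pi.smul_apply, Pi.smul_apply, e5, e6,
      e4, Pi.sub_apply, smul_eq_mul, smul_eq_mul]
    refine le_trans ?_ (le_abs_self _)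
    have hex := G.e_pos x
    have hp : 0 < G.potential c h x := hm.trans_le (hφ x hx)
    have hp' : 0 < G.potential c h' x := hm.trans_le (hφ' x hx)
    have hEx : (G.e x)⁻¹ ≤ E := (le_abs_self _).trans (hE x hx)
    have hinv : (G.potential c h x)⁻¹ ≤ m⁻¹ := inv_anti₀ hm (hφ x hx)
    have hinv' : (G.potential c h' x)⁻¹ ≤ m⁻¹ := inv_anti₀ hm (hφ' x hx)
    have h1 : |(h x).re - (h' x).re| ≤ ‖h x - h' x‖ := by
      rw [← Complex.sub_re]; exact Complex.abs_re_le_norm _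
    have h2 : |(h' x).re| ≤ ‖h' x‖ := Complex.abs_re_le_norm _
    have h3 := hD h h' x hx
    have e : G.coleHopf c h x - G.coleHopf c h' x =
        -(2 * (G.e x)⁻¹ * (G.potential c h x)⁻¹ * ((h x).re - (h' x).re)) +
        2 * (G.e x)⁻¹ * ((G.potential c h x)⁻¹ * (G.potential c h' x)⁻¹) *
          ((h' x).re * (G.potential c h x - G.potential c h' x)) := by
      rw [coleHopf, coleHopf]
      field_simp
      ring
    rw [e, Real.norm_eq_abs]
    refine (abs_add_le _ _).trans (add_le_add ?_ ?_)
    · rw [abs_neg, abs_mul, abs_of_nonneg (by positivity)]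
      calc _ ≤ 2 * E * m⁻¹ * ‖h x - h' x‖ := by gcongr
        _ = _ := by rw [ha]; ring
    · rw [abs_mul, abs_mul (h' x).re, abs_of_nonneg (by positivity)]
      calc _ ≤ 2 * E * (m⁻¹ * m⁻¹) * (‖h' x‖ * (D * ‖h - h'‖)) := by gcongr
        _ = _ := by rw [hb]; ring
  refine key.trans ((norm_add_le _ _).trans ?_)
  rw [norm_smul, norm_smul, hnn, hnn, Real.norm_of_nonneg ha0, Real.norm_of_nonneg (by positivity)]
  have := le_max_left a b
  have := le_max_right a b
  calc a * ‖h - h'‖ + b * ‖h - h'‖ * ‖h'‖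
      ≤ max a b * ‖h - h'‖ + max a b * ‖h - h'‖ * ‖h'‖ := by gcongr
    _ = _ := by ring

end GroundStateData

/-! ### Initial data and the main theorem -/

/-- Each variation sum grows by at most the factor `K`. It supplies the chain rule for the
exponential of a primitive of a merely integrable function. -/
theorem LipschitzOnWith.comp_absolutelyContinuousOnInterval {f g : ℝ → ℝ} {a b : ℝ} {K : ℝ≥0}
    (hg : LipschitzOnWith K g (f '' uIcc a b)) (hf : AbsolutelyContinuousOnInterval f a b) :
    AbsolutelyContinuousOnInterval (g ∘ f) a b := by
  have h := Tendsto.const_mul (K : ℝ) hf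
  rw [mul_zero] at h
  refine squeeze_zero' (Eventually.of_forall fun E => Finset.sum_nonneg fun _ _ => dist_nonneg)
    ?_ h
  refine mem_inf_of_right (mem_principal.2 fun E hE => ?_)
  change (_ : ℝ) ≤ _
  rw [Finset.mul_sum]
  exact Finset.sum_le_sum fun i hi =>
    hg.dist_le_mul _ (mem_image_of_mem f (hE.1 i hi).1) _ (mem_image_of_mem f (hE.1 i hi).2)

theorem lipschitzOnWith_exp_Iic (M : ℝ) :
    LipschitzOnWith (Real.exp M).toNNReal Real.exp (Iic M) := by
  refine (convex_Iic M).lipschitzOnWith_of_nnnorm_hasDerivWithin_le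
    (fun x _ => (Real.hasDerivAt_exp x).hasDerivWithinAt) fun x hx => ?_
  rw [← NNReal.coe_le_coe, coe_nnnorm, Real.coe_toNNReal _ (Real.exp_pos M).le,
    Real.norm_of_nonneg (Real.exp_pos x).le]
  exact Real.exp_le_exp.2 hx

theorem integral_mul_exp_primitive {f : ℝ → ℝ} (hf : IntegrableOn f (Icc 0 1)) {x : ℝ}
    (hx : x ∈ Icc (0 : ℝ) 1) :
    ∫ y in (0 : ℝ)..x, f y * Real.exp (∫ z in (0 : ℝ)..y, f z) =
      Real.exp (∫ y in (0 : ℝ)..x, f y) - 1 := by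
  have hfi := hf.intervalIntegrable_unit zero_mem_unit hx
  have hF := hfi.absolutelyContinuousOnInterval_intervalIntegral (c := 0) left_mem_uIcc
  obtain ⟨M, hM⟩ := isCompact_uIcc.exists_bound_of_continuousOn hF.continuousOn
  have hlip : LipschitzOnWith (Real.exp M).toNNReal Real.exp
      ((fun x => ∫ y in (0 : ℝ)..x, f y) '' uIcc 0 x) := by
    refine (lipschitzOnWith_exp_Iic M).mono ?_
    rintro _ ⟨y, hy, rfl⟩
    exact (le_abs_self _).trans (hM y hy)
  have h := (hlip.comp_absolutelyContinuousOnInterval hF).integral_deriv_eq_sub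
  simp only [Function.comp, intervalIntegral.integral_same, Real.exp_zero] at h
  rw [← h]
  refine intervalIntegral.integral_congr_ae ?_
  filter_upwards [hfi.ae_hasDerivAt_integral] with y hy hy'
  have := (hy (uIoc_subset_uIcc hy') 0 left_mem_uIcc).exp.deriv
  rw [mul_comm]
  exact this.symm

namespace GroundStateData

variable {V : ℝ → ℝ} (G : GroundStateData V)

/-- Every datum is in the range of the Cole–Hopf map. -/
theorem exists_coleHopf_eq (u₀ : L2I) : ∃ (c : ℝ) (w₀ : L2C) (m : ℝ), 0 < m ∧
    (∀ x ∈ Icc (0 : ℝ) 1, m ≤ G.potential c w₀ x) ∧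
    u₀ =ᵐ[volume.restrict (Icc (0 : ℝ) 1)] G.coleHopf c w₀ := by
  -- Solving `u₀ = -2 (r + φ'/φ)` for `φ'/φ`; the heat datum below is then `e φ' = e φ f`.
  set f : ℝ → ℝ := fun x => -2⁻¹ * (u₀ x + 2 * G.r x) with hf
  have hr2 : MemLp (fun x => 2 * G.r x) 2 (volume.restrict (Icc (0 : ℝ) 1)) := by
    obtain ⟨C, hC⟩ := isCompact_Icc.exists_bound_of_continuousOn G.cont_r
    exact (MemLp.of_bound (G.cont_r.aestronglyMeasurable measurableSet_Icc) C
      ((ae_restrict_iff' measurableSet_Icc).2 (Eventually.of_forall hC))).const_mul 2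
  have hf2 : MemLp f 2 (volume.restrict (Icc (0 : ℝ) 1)) :=
    ((Lp.memLp u₀).add hr2).const_mul (-2⁻¹)
  have hfi : IntegrableOn f (Icc 0 1) := hf2.integrable (by norm_num)
  set φ : ℝ → ℝ := fun x => Real.exp (∫ y in (0 : ℝ)..x, f y) with hφ
  have hφc : ContinuousOn φ (Icc 0 1) := by
    have := intervalIntegral.continuousOn_primitive_interval (a := 0) (b := 1) (f := f)
      (μ := volume)
    rw [uIcc_of_le zero_le_one] at this
    exact Real.continuous_exp.comp_continuousOn (this hfi)
  have hg : ContinuousOn (fun x => G.e x * φ x) (Icc 0 1) := G.cont_e.continuousOn.mul hφc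
  obtain ⟨C, hC⟩ := isCompact_Icc.exists_bound_of_continuousOn hg
  have hw : MemLp (fun x => ((G.e x * φ x * f x : ℝ) : ℂ)) 2
      (volume.restrict (Icc (0 : ℝ) 1)) := by
    refine hf2.of_le_mul (c := C) ?_ ?_
    · exact Complex.continuous_ofReal.comp_aestronglyMeasurable
        ((hg.aestronglyMeasurable measurableSet_Icc).mul hf2.aestronglyMeasurable)
    · refine (ae_restrict_iff' measurableSet_Icc).2 (Eventually.of_forall fun x hx => ?_)
      rw [Complex.norm_real, norm_mul]
      gcongr
      exact hC x hx
  have hT : ∀ x ∈ Icc (0 : ℝ) 1, G.T (hw.toLp) x = ((φ x - 1 : ℝ) : ℂ) := by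
    intro x hx
    have e : φ x - 1 = ∫ y in (0 : ℝ)..x, f y * φ y := (integral_mul_exp_primitive hfi hx).symm
    rw [e, ← intervalIntegral.integral_ofReal, T]
    refine intervalIntegral.integral_congr_ae ?_
    filter_upwards [ae_eq_of_Icc hx (MemLp.coeFn_toLp hw)] with y hy hy'
    rw [hy hy']
    have := G.e_ofReal_ne_zero y
    push_cast
    field_simp
  -- The constant `1` is `φ 0`, and the mean compensates the one subtracted in `potential`.
  have hpot : ∀ x ∈ Icc (0 : ℝ) 1,
      G.potential (1 + (G.meanT hw.toLp).re) hw.toLp x = φ x := fun x hx => by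
    rw [potential, hT x hx, Complex.sub_re, Complex.ofReal_re]; ring
  obtain ⟨x₀, hx₀, hmin⟩ := isCompact_Icc.exists_isMinOn ⟨0, zero_mem_unit⟩ hφc
  refine ⟨1 + (G.meanT hw.toLp).re, hw.toLp, φ x₀, Real.exp_pos _, fun x hx => ?_, ?_⟩
  · rw [hpot x hx]; exact hmin hx
  · filter_upwards [MemLp.coeFn_toLp hw, ae_restrict_mem measurableSet_Icc] with x hx hxI
    rw [coleHopf, hpot x hxI, hx, Complex.ofReal_re]
    have h1 := (G.e_pos x).ne'
    have h2 : φ x ≠ 0 := (Real.exp_pos _).ne'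
    simp only [hf]
    field_simp
    ring

/-- Existence of global solutions, and convergence to the steady state. -/
theorem exists_solution (hV : ContDiffOn ℝ 1 V (Icc 0 1)) {s₀ : L2I}
    (hs₀ : s₀ =ᵐ[volume.restrict (Icc (0 : ℝ) 1)] fun x => -2 * G.r x) (u₀ : L2I) :
    ∃ u : ℝ≥0 → L2I, IsGlobalBurgersSolution V u₀ u ∧ Tendsto u atTop (𝓝 s₀) := by
  obtain ⟨c, w₀, m, hm, hpos, hu₀⟩ := G.exists_coleHopf_eq u₀
  obtain ⟨h, h1, h2, h3, h4⟩ := G.exists_heat_orbit w₀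
  have hsol := G.isHeatSolution_of_orbit c h1 h2
  obtain ⟨D, hD0, hD⟩ := G.exists_potential_sub_le c
  -- The potential is Lipschitz from `L²` to the sup norm, so the lower bound at time `0` persists
  -- up to `ε` for small times, as the minimum principle requires.
  have hlow : ∀ t > 0, ∀ x ∈ Icc (0 : ℝ) 1, m ≤ G.potential c (h 0 t) x := by
    intro t ht x hx
    refine hsol.le_of_eventually_le (fun ε hε => ?_) ht hx
    have hlim : Tendsto (fun t => D * ‖h 0 t - w₀‖) (𝓝[>] 0) (𝓝 0) := by
      simpa using (tendsto_iff_norm_sub_tendsto_zero.1 h3).const_mul D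
    filter_upwards [hlim.eventually_lt_const hε] with s hs y hy
    have := (abs_le.1 ((hD (h 0 s) w₀ y hy).trans hs.le)).1
    have := hpos y hy
    change m - ε ≤ G.potential c (h 0 s) y
    linarith
  -- As the orbit decays, its potential tends to `c`; thus `c` is positive and the Cole–Hopf map is
  -- defined at the limit `0`.
  have hc : m ≤ c := by
    have hlim : Tendsto (fun t => c + D * ‖h 0 t‖) atTop (𝓝 c) := by
      simpa using (h4.norm.const_mul D).const_add c
    refine ge_of_tendsto hlim ?_
    · filter_upwards [eventually_gt_atTop 0] with t ht
      have e1 := (abs_le.1 (hD (h 0 t) 0 0 zero_mem_unit)).2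
      rw [sub_zero, G.potential_zero c zero_mem_unit] at e1
      linarith [hlow t ht 0 zero_mem_unit]
  -- Only the right limit of `h 0` at time `0` is known, so the initial value is inserted by hand.
  set k : ℝ≥0 → L2C := fun t => if t = 0 then w₀ else h 0 t with hk
  have hklow : ∀ t, ∀ x ∈ Icc (0 : ℝ) 1, m ≤ G.potential c (k t) x := by
    intro t
    by_cases ht : t = 0
    · simpa [hk, ht] using hpos
    · simpa [hk, ht] using hlow t (NNReal.coe_pos.2 (pos_iff_ne_zero.2 ht))
  have hmem : ∀ t, MemLp (G.coleHopf c (k t)) 2 (volume.restrict (Icc (0 : ℝ) 1)) := fun t =>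
    G.memLp_coleHopf fun x hx => hm.trans_le (hklow t x hx)
  obtain ⟨A, hA0, hA⟩ := G.exists_coleHopf_sub_le c hm
  have hcoe : ∀ t, (hmem t).toLp =ᵐ[volume.restrict (Icc (0 : ℝ) 1)] G.coleHopf c (k t) :=
    fun t => MemLp.coeFn_toLp (hmem t)
  have htend : ∀ {l : Filter ℝ≥0} {k' : L2C} {u' : L2I},
      (∀ x ∈ Icc (0 : ℝ) 1, m ≤ G.potential c k' x) →
      u' =ᵐ[volume.restrict (Icc (0 : ℝ) 1)] G.coleHopf c k' →
      Tendsto k l (𝓝 k') → Tendsto (fun t => (hmem t).toLp) l (𝓝 u') := by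
    intro l k' u' hk' hu' hl
    rw [tendsto_iff_norm_sub_tendsto_zero] at hl ⊢
    refine squeeze_zero (fun _ => norm_nonneg _)
      (fun t => hA (k t) k' _ _ (hklow t) hk' (hcoe t) hu') ?_
    simpa using hl.const_mul (A * (1 + ‖k'‖))
  have hkc : Continuous k := by
    rw [continuous_iff_continuousAt]
    intro t
    by_cases ht : t = 0
    · subst ht
      rw [continuousAt_iff_punctured_nhds]
      have h5 : Tendsto (fun s : ℝ≥0 => (s : ℝ)) (𝓝[≠] 0) (𝓝[>] 0) := by
        refine tendsto_nhdsWithin_iff.2 ⟨?_, ?_⟩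
        · exact (NNReal.continuous_coe.tendsto 0).mono_left nhdsWithin_le_nhds
        · filter_upwards [self_mem_nhdsWithin] with s hs
          exact NNReal.coe_pos.2 (pos_iff_ne_zero.2 hs)
      have h6 : k 0 = w₀ := by simp [hk]
      rw [h6]
      refine (h3.comp h5).congr' ?_
      filter_upwards [self_mem_nhdsWithin] with s hs
      simp only [hk, Function.comp, if_neg (show s ≠ 0 from hs)]
    · have ht' : (0 : ℝ) < t := NNReal.coe_pos.2 (pos_iff_ne_zero.2 ht)
      have h5 : ContinuousAt (fun s : ℝ≥0 => h 0 s) t :=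
        ContinuousAt.comp (f := fun s : ℝ≥0 => (s : ℝ)) (h2 0 t ht').continuousAt
          NNReal.continuous_coe.continuousAt
      refine h5.congr ?_
      filter_upwards [isOpen_ne.mem_nhds ht] with s hs
      simp only [hk, if_neg (show s ≠ 0 from hs)]
  refine ⟨fun t => (hmem t).toLp, ⟨?_, ?_, _, hsol.isClassicalBurgersSolution hV
    fun t ht x hx => hm.trans_le (hlow t ht x hx), fun t ht => ?_⟩, ?_⟩
  · exact continuous_iff_continuousAt.2 fun t => htend (hklow t) (hcoe t) hkc.continuousAt
  · refine Lp.ext ((hcoe 0).trans ?_)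
    have h6 : k 0 = w₀ := by simp [hk]
    rw [h6]
    exact hu₀.symm
  · have h6 : k t = h 0 t := by simp [hk, ht.ne']
    filter_upwards [hcoe t, h1 0 t (NNReal.coe_pos.2 ht)] with x e1 e2
    rw [e1, h6, coleHopf, e2]
    rfl
  · refine htend (k' := 0) (fun x hx => ?_) ?_ ?_
    · rwa [G.potential_zero c hx]
    · filter_upwards [hs₀, Lp.coeFn_zero ℂ 2 (volume.restrict (Icc (0 : ℝ) 1))] with x e1 e2
      rw [e1, coleHopf, e2]
      simp
    · refine (h4.comp (NNReal.tendsto_coe_atTop.2 tendsto_id)).congr' ?_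
      filter_upwards [eventually_gt_atTop 0] with t ht
      simp [hk, ht.ne']

end GroundStateData

/-- Time translates of global solutions are global solutions. -/
theorem IsGlobalBurgersSolution.shift {V : ℝ → ℝ} {u₀ : L2I} {u : ℝ≥0 → L2I}
    (h : IsGlobalBurgersSolution V u₀ u) (s : ℝ≥0) :
    IsGlobalBurgersSolution V (u s) fun t => u (t + s) := by
  obtain ⟨hc, -, w, ⟨wt, wx, wxx, hw, hwt, hwx, hwxx, hb, hd⟩, hu⟩ := h
  have hs : ∀ t > 0, (0 : ℝ) < t + s := fun t ht => add_pos_of_pos_of_nonneg ht s.2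
  have hcomp : ∀ {f : ℝ → ℝ → ℝ}, ContinuousOn (fun p : ℝ × ℝ => f p.1 p.2) (Ioi 0 ×ˢ Icc 0 1) →
      ContinuousOn (fun p : ℝ × ℝ => f (p.1 + s) p.2) (Ioi 0 ×ˢ Icc 0 1) := fun hf =>
    hf.comp (f := fun p : ℝ × ℝ => (p.1 + s, p.2)) (by fun_prop)
      fun p hp => ⟨hs p.1 hp.1, hp.2⟩
  refine ⟨by fun_prop, by simp, fun t => w (t + s), ⟨fun t => wt (t + s), fun t => wx (t + s),
    fun t => wxx (t + s), hcomp hw, hcomp hwt, hcomp hwx, hcomp hwxx, fun t ht => hb _ (hs t ht),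
    fun t ht x hx => ⟨?_, (hd _ (hs t ht) x hx).2⟩⟩, fun t ht => ?_⟩
  · exact (hd _ (hs t ht) x hx).1.comp_add_const t s
  · exact hu (t + s) (add_pos_of_pos_of_nonneg ht zero_le)

theorem mainTheorem1 (V : ℝ → ℝ) (hV : ContDiffOn ℝ 1 V (Icc 0 1)) :
    -- every datum in `L²([0,1])` has exactly one global solution
    (∀ u₀ : L2I, ∃! u : ℝ≥0 → L2I, IsGlobalBurgersSolution V u₀ u) ∧
    -- the positive ground state exists and is unique
    ∃ e₀ : ℝ → ℝ, IsPositiveGroundState V e₀ ∧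
      (∀ e : ℝ → ℝ, IsPositiveGroundState V e → EqOn e e₀ (Icc 0 1)) ∧
      -- the solutions form a (semi)flow `Φ` on `L²([0,1])`, and `s₀ = -2 ∂ₓe₀ / e₀`
      ∃ (Φ : Flow ℝ≥0 L2I) (s₀ : L2I),
        (∀ u₀ : L2I, IsGlobalBurgersSolution V u₀ (fun t => Φ t u₀)) ∧
        ((s₀ : ℝ → ℝ) =ᵐ[volume.restrict (Icc (0 : ℝ) 1)]
          fun x => -2 * derivWithin e₀ (Icc 0 1) x / e₀ x) ∧
        -- `s₀` is the unique steady state of the flow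
        (∀ s : L2I, (∀ t : ℝ≥0, Φ t s = s) ↔ s = s₀) ∧
        -- `s₀` attracts every orbit
        ∀ u₀ : L2I, Tendsto (fun t : ℝ≥0 => Φ t u₀) atTop (𝓝 s₀) := by
  obtain ⟨G⟩ := nonempty_groundStateData hV.continuousOn
  have hr : MemLp (fun x => -2 * G.r x) 2 (volume.restrict (Icc (0 : ℝ) 1)) := by
    obtain ⟨C, hC⟩ := isCompact_Icc.exists_bound_of_continuousOn G.cont_r
    exact (MemLp.of_bound (G.cont_r.aestronglyMeasurable measurableSet_Icc) C
      ((ae_restrict_iff' measurableSet_Icc).2 (Eventually.of_forall hC))).const_mul (-2)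
  obtain ⟨s₀, hs₀⟩ : ∃ s₀ : L2I, s₀ =ᵐ[volume.restrict (Icc (0 : ℝ) 1)] fun x => -2 * G.r x :=
    ⟨hr.toLp, MemLp.coeFn_toLp hr⟩
  choose Φ hΦ hlim using G.exists_solution hV hs₀
  refine ⟨fun u₀ => ⟨Φ u₀, hΦ u₀, fun v hv => hv.unique (hΦ u₀)⟩, G.e,
    G.isPositiveGroundState hV.continuousOn,
    fun e he => G.eqOn_of_isPositiveGroundState hV.continuousOn he, ?_⟩
  have hcont := continuous_of_isGlobalBurgersSolution hV (Φ := fun t u₀ => Φ u₀ t) hΦ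
  -- The semigroup law is uniqueness applied to a time-translated solution.
  have hadd : ∀ (t s : ℝ≥0) (u₀ : L2I), Φ u₀ (t + s) = Φ (Φ u₀ s) t := fun t s u₀ =>
    congrFun (((hΦ u₀).shift s).unique (hΦ (Φ u₀ s))) t
  have hzero : ∀ u₀ : L2I, Φ u₀ 0 = u₀ := fun u₀ => (hΦ u₀).2.1
  obtain ⟨F, hF⟩ : ∃ F : Flow ℝ≥0 L2I, ∀ t u₀, F t u₀ = Φ u₀ t :=
    ⟨⟨fun t u₀ => Φ u₀ t, hcont, hadd, hzero⟩, fun _ _ => rfl⟩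
  -- The time-`t` map is continuous and a shifted orbit has the same limit. The orbit of `0` is an
  -- arbitrary choice.
  have hfix : ∀ t, Φ s₀ t = s₀ := fun t => by
    have h1 : Tendsto (fun s => Φ (Φ 0 s) t) atTop (𝓝 (Φ s₀ t)) :=
      ((hcont.comp (Continuous.prodMk_right t)).tendsto s₀).comp (hlim 0)
    have h2 : Tendsto (fun s => Φ (Φ 0 s) t) atTop (𝓝 s₀) := by
      simp only [← hadd]
      exact (hlim 0).comp (tendsto_atTop_mono (fun _ => le_add_self) tendsto_id)
    exact tendsto_nhds_unique h1 h2
  refine ⟨F, s₀, fun u₀ => by simpa only [hF] using hΦ u₀, ?_, fun s => ⟨fun h => ?_, ?_⟩,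
    fun u₀ => by simpa only [hF] using hlim u₀⟩
  · filter_upwards [hs₀, ae_restrict_mem measurableSet_Icc] with x hx hxI
    have := (G.e_pos x).ne'
    rw [hx, (G.hasDeriv_e x hxI).derivWithin_unit hxI]
    field_simp
  · have h1 : Tendsto (Φ s) atTop (𝓝 s) := by
      rw [show Φ s = fun _ => s from funext fun t => (hF t s).symm.trans (h t)]
      exact tendsto_const_nhds
    exact tendsto_nhds_unique h1 (hlim s)
  · rintro rfl t
    exact (hF t s).trans (hfix t)
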